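/- Let $n\ge 0$ be an integer and $m\in\mathbb R$; all functions and distributions are real-valued, $\mathcal S=\mathcal S(\mathbb R^n,\mathbb R)$. **Brackets and star products of fields at equal time.** A Hamiltonian function is a smooth function $f(u_\alpha,\xi_\beta)$ of finitely many of the variables $u_\alpha,\xi_\beta$, $\alpha,\beta\in\mathbb N^n$; for $\varphi,\pi\in\mathcal S$ its density is $f(\partial^\alpha\varphi(x),\partial^\beta\pi(x))$. Put $\partial_{u,x}=\sum_\alpha\frac{\partial}{\partial u_\alpha}\partial_x^\alpha$, $\partial_{\xi,x}=\sum_\beta\frac{\partial}{\partial \xi_\beta}\partial_x^\beta$, where $\partial_x^\alpha$ acts only on the distribution factor $\delta(x-y)$, and likewise $\partial_{v,y},\partial_{\eta,y}$. For Hamiltonian functions $f(u,\xi)$, $g(v,\eta)$ assigned to the points $x$, $y$, $$\{f,g\}_\delta=(\partial_{u,x}\partial_{\eta,y}-\partial_{\xi,x}\partial_{v,y})\big(f\,g\,\delta(x-y)\big),\qquad f\star_\delta g=fg+\sum_{k\ge1}\frac{\hbar^k}{k!}(\partial_{u,x}\partial_{\eta,y}-\partial_{\xi,x}\partial_{v,y})^k\big(f\,g\,\delta(x-y)\big),$$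 evaluated at $u_\alpha=\partial^\alpha\varphi(x)$, $\xi_\beta=\partial^\beta\pi(x)$, $v_\alpha=\partial^\alpha\varphi(y)$, $\eta_\beta=\partial^\beta\pi(y)$. These are, for each $y$, a tempered distribution in $x$, respectively a formal power series in $\hbar$ with such coefficients. In particular $\{\pi(x),\varphi(y)\}_\delta=-\delta(x-y)$ and $\{\varphi(x),\varphi(y)\}_\delta=0$. **Klein–Gordon equation.** There is exactly one curve $t\mapsto\Delta(t,\cdot)$ of tempered distributions on $\mathbb R^n$, twice weakly differentiable in $t$, with $$(\partial_t^2-\triangle_x+m^2)\Delta=0,\qquad \Delta(0,\cdot)=0,\qquad \partial_t\Delta(0,\cdot)=\delta .$$ Convolution with $\Delta(t,\cdot)$ and with $\partial_t\Delta(t,\cdot)$ maps $\mathcal S$ continuously to $\mathcal S$, so that both can be convolved with any tempered distribution. For all $\varphi,\pi\in\mathcal S$ the Cauchy problem $(\partial_t^2-\triangle_x+m^2)\phi=0$, $\phi(0,x)=\varphi(x)$, $\phi_t(0,x)=\pi(x)$ has a solution $t\mapsto\phi(t,\cdot)$, twice differentiable as a curve in $\mathcal S$, and every such solution is given by $\phi(t,\cdot)=\Delta(t,\cdot)*\pi+\partial_t\Delta(t,\cdot)*\varphi$.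 **Bracket.** For $s,t\in\mathbb R$ extend the bracket from the Cauchy data $(\phi(s,\cdot),\phi_t(s,\cdot))$ at time $s$ by (convolution in the variable $x$) $$\{\phi(t,x),\phi(s,y)\}:=\Delta(t-s,\cdot)*\{\phi_t(s,x),\phi(s,y)\}_\delta+\partial_t\Delta(t-s,\cdot)*\{\phi(s,x),\phi(s,y)\}_\delta .$$ Then for all $s,t\in\mathbb R$ and $y\in\mathbb R^n$, as distributions in $x$, $$\{\phi(t,x),\phi(s,y)\}=-\Delta(t-s,x-y);$$ for $s=0$ this reads $\{\phi(t,x),\varphi(y)\}=-\Delta(t,x-y)$. The same distribution is obtained by extending the bracket $\{\cdot,\cdot\}_\delta$ of the initial data $(\varphi,\pi)$ at time $0$ bilinearly, by convolution in $x$ and in $y$, to $\phi(t,\cdot)=\Delta(t,\cdot)*\pi+\partial_t\Delta(t,\cdot)*\varphi$ and $\phi(s,\cdot)=\Delta(s,\cdot)*\pi+\partial_t\Delta(s,\cdot)*\varphi$. **Star product.** Define the star product, a formal power series in $\hbar$ whose coefficients are distributions in $x$ for each $y$, by $$\phi(t,x)\star\phi(s,y):=\Delta(t-s,\cdot)*\big(\phi_t(s,x)\star_\delta\phi(s,y)\big)+\partial_t\Delta(t-s,\cdot)*\big(\phi(s,x)\star_\delta\phi(s,y)\big).$$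 Then for all $s,t\in\mathbb R$ and $y\in\mathbb R^n$ $$\phi(t,x)\star\phi(s,y)=\phi(t,x)\,\phi(s,y)+\hbar\,\{\phi(t,x),\phi(s,y)\}.$$ -/

import Mathlib

open scoped SchwartzMap Laplacian LineDeriv Topology ContDiff

noncomputable section

namespace Peierls

/-! ### Space, test functions, distributions -/

/-- The space `ℝⁿ`. -/
abbrev Space (n : ℕ) := EuclideanSpace ℝ (Fin n)

/-- Real valued Schwartz functions on `ℝⁿ`. -/
abbrev Test (n : ℕ) := 𝓢(Space n, ℝ)

/-- Real tempered distributions on `ℝⁿ`. -/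
abbrev Dist (n : ℕ) := Test n →L[ℝ] ℝ

/-- Multi-indices. -/
abbrev MultiIndex (n : ℕ) := Fin n →₀ ℕ

/-- The operator `∂^α` on Schwartz functions. -/
def mderiv {n : ℕ} (α : MultiIndex n) : Test n →L[ℝ] Test n :=
  ((List.finRange n).map fun i =>
    (LineDeriv.lineDerivOpCLM ℝ (Test n) (EuclideanSpace.single i (1 : ℝ))) ^ (α i)).prod

/-- `translate a χ` is the function `z ↦ χ (z + a)`. -/
def translate {n : ℕ} (a : Space n) : Test n →L[ℝ] Test n :=
  SchwartzMap.compSubConstCLM ℝ (-a)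

/-- `reflect χ` is the function `z ↦ χ (-z)`. -/
def reflect {n : ℕ} : Test n →L[ℝ] Test n :=
  SchwartzMap.compCLMOfContinuousLinearEquiv ℝ (ContinuousLinearEquiv.neg ℝ)

/-- The Dirac distribution at `y`, that is `δ(x - y)` as a distribution in `x`. -/
def dirac {n : ℕ} (y : Space n) : Dist n :=
  (BoundedContinuousFunction.evalCLM ℝ y).comp
    (SchwartzMap.toBoundedContinuousFunctionCLM ℝ (Space n) ℝ)

/-- The distribution `χ ↦ ∫ c(x) χ(x) dx` given by a function `c` of temperate growth. -/
def ofFunction {n : ℕ} (c : Space n → ℝ) : Dist n :=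
  (SchwartzMap.integralCLM ℝ MeasureTheory.volume).comp (SchwartzMap.smulLeftCLM ℝ c)

/-- For a distribution `F(x)`, the distribution `F(x - y)` in the variable `x`:
`⟨F(x - y), χ(x)⟩ = ⟨F(z), χ(z + y)⟩`. -/
def shift {n : ℕ} (F : Dist n) (y : Space n) : Dist n := F.comp (translate y)

/-! ### Convolution

A distribution in `(x, y)` is given as a family `y ↦ B y` of distributions in `x`, which is
possible for all the kernels that occur (they depend smoothly on the parameter `y`). -/

/-- The convolution `(F ∗ φ)(x) = ⟨F(z), φ(x - z)⟩` of a distribution and a Schwartz function. -/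
def convFun {n : ℕ} (F : Dist n) (φ : Test n) (x : Space n) : ℝ :=
  F (reflect (translate x φ))

/-- `T` is the transpose of convolution by `F`: `(T χ)(x) = ⟨F(z), χ(x + z)⟩`. -/
def IsConvTranspose {n : ℕ} (F : Dist n) (T : Test n →L[ℝ] Test n) : Prop :=
  ∀ (χ : Test n) (x : Space n), T χ x = F (translate x χ)

/-- `F` can be convolved with every tempered distribution. -/
def IsConvolutor {n : ℕ} (F : Dist n) : Prop := ∃ T, IsConvTranspose F T

open scoped Classical in
/-- The convolution `F ∗ B`, `⟨F ∗ B, χ⟩ = ⟨B(x), ⟨F(z), χ(x + z)⟩⟩`, of a convolutor `F` and a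
tempered distribution `B` (by convention it is zero if `F` is not a convolutor). -/
def conv {n : ℕ} (F B : Dist n) : Dist n :=
  if h : IsConvolutor F then B.comp h.choose else 0

/-- `C` is the convolution by `F` in the parameter `y` of the kernel `B`:
`⟨C y, χ⟩ = ⟨F(z), ⟨B (y - z), χ⟩⟩`, the inner pairing being a Schwartz function of `z`. -/
def IsConvParam {n : ℕ} (F : Dist n) (B C : Space n → Dist n) : Prop :=
  ∀ (y : Space n) (χ : Test n), ∃ ψ : Test n, (∀ z, ψ z = B (y - z) χ) ∧ C y χ = F ψ

open scoped Classical in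
/-- The convolution `F ∗ B` in the parameter `y` of the kernel `B` (by convention it is zero if it
does not exist). -/
def convParam {n : ℕ} (F : Dist n) (B : Space n → Dist n) : Space n → Dist n :=
  if h : ∃ C, IsConvParam F B C then h.choose else 0

/-! ### Hamiltonian functions, Poisson bracket and star product -/

/-- Values of the variables `u_α` (`Sum.inl α`) and `ξ_β` (`Sum.inr β`). -/
abbrev Jet (n : ℕ) := MultiIndex n ⊕ MultiIndex n → ℝ

/-- Hamiltonian functions: smooth functions of finitely many of the variables `u_α`, `ξ_β`. -/
structure HamFun (n : ℕ) where
  toFun : Jet n → ℝ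
  smooth' : ∃ (S : Finset (MultiIndex n ⊕ MultiIndex n)) (g : (S → ℝ) → ℝ),
    ContDiff ℝ ∞ g ∧ ∀ j, toFun j = g fun i => j i

/-- A coordinate as a Hamiltonian function. -/
def HamFun.coord {n : ℕ} (i : MultiIndex n ⊕ MultiIndex n) : HamFun n where
  toFun j := j i
  smooth' := ⟨{i}, fun v => v ⟨i, Finset.mem_singleton_self i⟩, by fun_prop, fun _ => rfl⟩

/-- The Hamiltonian function `u_0`; its density is the field `φ(x)` itself. -/
def HamFun.phi {n : ℕ} : HamFun n := HamFun.coord (Sum.inl 0)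

/-- The Hamiltonian function `ξ_0`; its density is the conjugate field `π(x)` itself. -/
def HamFun.pi {n : ℕ} : HamFun n := HamFun.coord (Sum.inr 0)

/-- Functions of two groups of variables, `(u, ξ)` assigned to `x` and `(v, η)` assigned to `y`. -/
abbrev Coeff (n : ℕ) := Jet n → Jet n → ℝ

/-- Partial derivative in a variable of the first group. -/
def Coeff.d₁ {n : ℕ} (i : MultiIndex n ⊕ MultiIndex n) (F : Coeff n) : Coeff n :=
  fun j k => deriv (fun s => F (Function.update j i s) k) (j i)

/-- Partial derivative in a variable of the second group. -/
def Coeff.d₂ {n : ℕ} (i : MultiIndex n ⊕ MultiIndex n) (F : Coeff n) : Coeff n :=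
  fun j k => deriv (fun s => F j (Function.update k i s)) (k i)

/-- Formal sums `∑ K (γ, σ) ∂_x^γ ∂_y^σ δ(x - y)` with coefficients that are functions of the
variables `(u, ξ)` and `(v, η)`. -/
abbrev FormalKernel (n : ℕ) := MultiIndex n × MultiIndex n → Coeff n

/-- The formal kernel `f(u, ξ) g(v, η) δ(x - y)`. -/
def FormalKernel.mulDelta {n : ℕ} (f g : HamFun n) : FormalKernel n :=
  fun p j k => if p = 0 then f.toFun j * g.toFun k else 0

/-- The operator `∂_{u,x} ∂_{η,y} - ∂_{ξ,x} ∂_{v,y}` where `∂_{u,x} = ∑_α ∂/∂u_α ∂_x^α` and so on;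
the derivatives `∂_x^α`, `∂_y^β` act on the distribution factor, `∂/∂u_α` etc. on the
coefficient. -/
def FormalKernel.poissonOp {n : ℕ} (K : FormalKernel n) : FormalKernel n := fun p j k =>
  ∑ a ∈ Finset.HasAntidiagonal.antidiagonal p.1, ∑ b ∈ Finset.HasAntidiagonal.antidiagonal p.2,
    (Coeff.d₁ (Sum.inl a.1) (Coeff.d₂ (Sum.inr b.1) (K (a.2, b.2))) j k -
      Coeff.d₁ (Sum.inr a.1) (Coeff.d₂ (Sum.inl b.1) (K (a.2, b.2))) j k)

/-- The values at `x` of all derivatives of a pair of fields `(φ, π)`. -/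
def jet {n : ℕ} (φ π : Test n) (x : Space n) : Jet n :=
  Sum.elim (fun α => mderiv α φ x) (fun β => mderiv β π x)

/-- `∂_x^γ ∂_y^σ δ(x - y)` as a distribution in `x`: since `∂_y δ(x - y) = - ∂_x δ(x - y)`, its
value at `χ` is `(-1)^{|γ|} (∂^{γ+σ} χ)(y)`. -/
def deltaDeriv {n : ℕ} (p : MultiIndex n × MultiIndex n) (y : Space n) : Dist n :=
  ((-1 : ℝ) ^ p.1.degree) • (dirac y).comp (mderiv (p.1 + p.2))

/-- Substitution of the fields `(φ, π)` at `x` and at `y` in a formal kernel. -/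
def FormalKernel.eval {n : ℕ} (K : FormalKernel n) (φ π : Test n) (y : Space n) : Dist n :=
  ∑ᶠ p, (deltaDeriv p y).comp
    (SchwartzMap.smulLeftCLM ℝ fun x => K p (jet φ π x) (jet φ π y))

/-- The Poisson bracket `{f(∂φ(x), ∂π(x)), g(∂φ(y), ∂π(y))}_δ` of two Hamiltonian densities, a
distribution in `x` depending on `y`. -/
def bracketDelta {n : ℕ} (f g : HamFun n) (φ π : Test n) (y : Space n) : Dist n :=
  (FormalKernel.mulDelta f g).poissonOp.eval φ π y

/-- The star product `f(∂φ(x), ∂π(x)) ⋆_δ g(∂φ(y), ∂π(y))` of two Hamiltonian densities, a formal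
power series in `ħ` given as the sequence of its coefficients: the coefficient of `ħ^0` is the
product, the one of `ħ^k`, `k ≥ 1`, is
`(1/k!) (∂_{u,x} ∂_{η,y} - ∂_{ξ,x} ∂_{v,y})^k (f g δ(x - y))`. -/
def starDelta {n : ℕ} (f g : HamFun n) (φ π : Test n) (y : Space n) : ℕ → Dist n
  | 0 => ofFunction fun x => f.toFun (jet φ π x) * g.toFun (jet φ π y)
  | k + 1 => ((k + 1).factorial : ℝ)⁻¹ •
      (FormalKernel.poissonOp^[k + 1] (FormalKernel.mulDelta f g)).eval φ π y

/-! ### The Klein–Gordon equation -/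

/-- The Klein–Gordon equation `∂_t² u - Δ u + m² u = 0` for a curve `u` of Schwartz functions,
differentiable in the Schwartz space, with time derivative `v`. -/
structure IsKleinGordon {n : ℕ} (m : ℝ) (u v : ℝ → Test n) : Prop where
  velocity : ∀ t, HasDerivAt u (v t) t
  equation : ∀ t, HasDerivAt v (Δ (u t) - m ^ 2 • u t) t

/-- The Cauchy problem with initial data `(φ, π)` at time `0`. -/
structure IsCauchySolution {n : ℕ} (m : ℝ) (φ π : Test n) (u v : ℝ → Test n) : Prop
    extends IsKleinGordon m u v where
  init : u 0 = φ
  init_velocity : v 0 = π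

/-- `G` is the Green function: the distributional solution of the Klein–Gordon equation with
`G(0) = 0`, `∂_t G(0) = δ`. Here `G'` is its time derivative `∂_t G`. -/
structure IsGreenFunction {n : ℕ} (m : ℝ) (G G' : ℝ → Dist n) : Prop where
  velocity : ∀ t χ, HasDerivAt (fun τ => G τ χ) (G' t χ) t
  equation : ∀ t χ, HasDerivAt (fun τ => G' τ χ) (G t (Δ χ - m ^ 2 • χ)) t
  init : G 0 = 0
  init_velocity : G' 0 = dirac 0

/-! ### Bracket and star product of the space-time fields

`G`, `G'` are the Green function and its time derivative; `u t` is the field `φ(t, ·)` and `v t` its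
time derivative. -/

/-- The bracket `{φ(t,x), φ(s,y)}` by extension from the Cauchy data at time `s`:
`G(t-s) ∗ {φ_t(s,x), φ(s,y)}_δ + ∂_t G(t-s) ∗ {φ(s,x), φ(s,y)}_δ`. -/
def bracket {n : ℕ} (G G' : ℝ → Dist n) (u v : ℝ → Test n) (t s : ℝ) (y : Space n) : Dist n :=
  conv (G (t - s)) (bracketDelta HamFun.pi HamFun.phi (u s) (v s) y) +
    conv (G' (t - s)) (bracketDelta HamFun.phi HamFun.phi (u s) (v s) y)

/-- The bracket `{φ(t,x), φ(s,y)}` by bilinear extension, in both arguments, from the Cauchy data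
`(φ, π)` at time `0`, by `φ(t,·) = G(t) ∗ π + ∂_t G(t) ∗ φ` and
`φ(s,·) = G(s) ∗ π + ∂_t G(s) ∗ φ`. -/
def bracketInitial {n : ℕ} (G G' : ℝ → Dist n) (φ π : Test n) (t s : ℝ) (y : Space n) :
    Dist n :=
  convParam (G s) (fun w => conv (G t) (bracketDelta HamFun.pi HamFun.pi φ π w)) y +
    convParam (G' s) (fun w => conv (G t) (bracketDelta HamFun.pi HamFun.phi φ π w)) y +
    convParam (G s) (fun w => conv (G' t) (bracketDelta HamFun.phi HamFun.pi φ π w)) y +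
    convParam (G' s) (fun w => conv (G' t) (bracketDelta HamFun.phi HamFun.phi φ π w)) y

/-- The star product `φ(t,x) ⋆ φ(s,y)`, a formal power series in `ħ`:
`G(t-s) ∗ (φ_t(s,x) ⋆_δ φ(s,y)) + ∂_t G(t-s) ∗ (φ(s,x) ⋆_δ φ(s,y))`. -/
def star {n : ℕ} (G G' : ℝ → Dist n) (u v : ℝ → Test n) (t s : ℝ) (y : Space n) : ℕ → Dist n :=
  fun k =>
    conv (G (t - s)) (starDelta HamFun.pi HamFun.phi (u s) (v s) y k) +
      conv (G' (t - s)) (starDelta HamFun.phi HamFun.phi (u s) (v s) y k)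

end Peierls

end

/-! ### Differentiability of curves in topological vector spaces -/

section Derivative

variable {F F' : Type*} [AddCommGroup F] [Module ℝ F] [TopologicalSpace F] [ContinuousSMul ℝ F]
  [AddCommGroup F'] [Module ℝ F'] [TopologicalSpace F'] [ContinuousSMul ℝ F']

/-! Everything is expressed through two operators on Schwartz functions, S(t) = sin(t√A)/√A and C(t)
= cos(t√A) with A = -Δ + m², built as Fourier multipliers (`sinProp`, `cosProp`). The symbol of S(t)
is t · `sincSqrt` (t² r), where `sincSqrt` is entire with all derivatives bounded on [0, ∞). Hence
the symbols have temperate growth and the curves S(t)χ, C(t)χ are differentiable in the Schwartz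
topology. The Green function is χ ↦ (S(t)χ)(0); since S(t) commutes with translations and
reflection, convolution with it is S(t) again.

Uniqueness is by duality: a weak solution at time t - τ paired with a Schwartz solution at time τ
gives a quantity constant in τ (`IsWeakKleinGordon.duality`). The product rule used there rests on
Banach–Steinhaus, hence on the Schwartz space being barrelled. Uniqueness in turn yields the
invariance, parity and addition rules of S and C.

Since {π, φ} = -δ and {φ, φ} = 0, only -S(t-s) survives in the bracket; from data at time 0 it
reappears through the formula for sin(a - b) (`sinProp_sub`). These brackets have constant
coefficients, so a second Poisson operator kills them and the star product stops at first order; its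
order zero is the propagation of the field from time s to time t. -/

theorem hasDerivAt_iff_tendsto_inv_smul {u : ℝ → F} {v : F} {t : ℝ} :
    HasDerivAt u v t ↔
      Filter.Tendsto (fun h : ℝ => h⁻¹ • (u (t + h) - u t - h • v)) (𝓝 0) (𝓝 0) := by
  rw [hasDerivAt_iff_hasFDerivAt, hasFDerivAt_iff_isLittleOTVS,
    Asymptotics.isLittleOTVS_iff_tendsto_inv_smul]
  · have : 𝓝 t = Filter.map (fun h => t + h) (𝓝 0) := by
      rw [map_add_left_nhds]; simp
    rw [this, Filter.tendsto_map'_iff]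
    simp [Function.comp_def]
  · refine Filter.Eventually.of_forall fun x hx => ?_
    have : x = t := by linarith
    simp [this]

theorem HasDerivAt.clm_apply_curve (L : F →L[ℝ] F') {u : ℝ → F} {v : F} {t : ℝ}
    (h : HasDerivAt u v t) : HasDerivAt (fun τ => L (u τ)) (L v) t := by
  rw [hasDerivAt_iff_tendsto_inv_smul] at h ⊢
  have := (L.continuous.tendsto 0).comp h
  simpa [Function.comp_def] using this

theorem HasDerivAt.comp_affine {u : ℝ → F} {v : F} {t s : ℝ} (c : ℝ)
    (h : HasDerivAt u v (s + c * t)) : HasDerivAt (fun τ => u (s + c * τ)) (c • v) t := by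
  rw [hasDerivAt_iff_tendsto_inv_smul] at h ⊢
  have h1 : Filter.Tendsto (fun h : ℝ => c * h) (𝓝 0) (𝓝 0) := by
    have : Continuous fun h : ℝ => c * h := by fun_prop
    simpa using this.tendsto 0
  have h2 := (h.comp h1).const_smul c
  rw [smul_zero] at h2
  refine h2.congr fun h => ?_
  -- For c = 0 the curve is constant; otherwise c · (c h)⁻¹ = h⁻¹.
  rcases eq_or_ne c 0 with rfl | hc
  · simp
  · simp only [Function.comp_apply, smul_smul]
    congr 1
    · field_simp
    · ring_nf

theorem HasDerivAt.add_curve [IsTopologicalAddGroup F] {u₁ u₂ : ℝ → F} {v₁ v₂ : F} {t : ℝ}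
    (h₁ : HasDerivAt u₁ v₁ t) (h₂ : HasDerivAt u₂ v₂ t) :
    HasDerivAt (fun τ => u₁ τ + u₂ τ) (v₁ + v₂) t := by
  rw [hasDerivAt_iff_tendsto_inv_smul] at h₁ h₂ ⊢
  have := h₁.add h₂
  rw [add_zero] at this
  refine this.congr fun h => ?_
  rw [← smul_add, smul_add h v₁ v₂]
  congr 1
  abel

end Derivative

/-! ### The Schwartz space is barrelled -/

namespace SchwartzMap

variable {E F : Type*} [NormedAddCommGroup E] [NormedSpace ℝ E]
  [NormedAddCommGroup F] [NormedSpace ℝ F]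

theorem eventually_seminorm_sub_lt {u : ℕ → 𝓢(E, F)} (hu : CauchySeq u) (k l : ℕ) {ε : ℝ}
    (hε : 0 < ε) : ∃ N, ∀ m ≥ N, ∀ n ≥ N, SchwartzMap.seminorm ℝ k l (u m - u n) < ε := by
  have h := cauchySeq_iff_tendsto.1 hu
  rw [uniformity_eq_comap_nhds_zero, Filter.tendsto_comap_iff] at h
  have hc : Continuous (SchwartzMap.seminorm ℝ k l : 𝓢(E, F) → ℝ) :=
    (schwartz_withSeminorms ℝ E F).continuous_seminorm (k, l)
  have h2 := (hc.tendsto 0).comp h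
  rw [map_zero] at h2
  have h3 := h2.eventually (gt_mem_nhds hε)
  rw [Filter.eventually_atTop] at h3
  obtain ⟨N, h4⟩ := h3
  exact ⟨max N.1 N.2, fun m hm n hn => h4 (n, m)
    ⟨(le_max_left _ _).trans hn, (le_max_right _ _).trans hm⟩⟩

theorem norm_pow_mul_iteratedFDeriv_sub_le (f g : 𝓢(E, F)) (k l : ℕ) (x : E) :
    ‖x‖ ^ k * ‖iteratedFDeriv ℝ l f x - iteratedFDeriv ℝ l g x‖ ≤
      SchwartzMap.seminorm ℝ k l (f - g) := by
  have := SchwartzMap.le_seminorm ℝ k l (f - g) x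
  rwa [show ((f - g : 𝓢(E, F)) : E → F) = (f : E → F) - g from rfl,
    iteratedFDeriv_sub_apply (f.smooth l).contDiffAt (g.smooth l).contDiffAt] at this

/-- The topology is given by countably many seminorms, so sequences suffice. For a Cauchy sequence
the derivatives of each order converge uniformly, so their limits form the Taylor series of a smooth
function, and the weighted bounds pass to the limit. -/
instance instCompleteSpace [CompleteSpace F] : CompleteSpace 𝓢(E, F) := by
  have : (uniformity 𝓢(E, F)).IsCountablyGenerated :=
    IsUniformAddGroup.uniformity_countably_generated
  refine UniformSpace.complete_of_cauchySeq_tendsto fun u hu => ?_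
  have hlim : ∀ l : ℕ, ∀ x : E, ∃ g, Filter.Tendsto (fun m => iteratedFDeriv ℝ l (u m) x)
      Filter.atTop (𝓝 g) := by
    intro l x
    refine cauchySeq_tendsto_of_complete (Metric.cauchySeq_iff.2 fun ε hε => ?_)
    obtain ⟨N, hN⟩ := eventually_seminorm_sub_lt hu 0 l hε
    refine ⟨N, fun m hm n hn => lt_of_le_of_lt ?_ (hN m hm n hn)⟩
    simpa [dist_eq_norm] using norm_pow_mul_iteratedFDeriv_sub_le (u m) (u n) 0 l x
  choose g hg using hlim
  have hbound : ∀ k l : ℕ, ∀ ε > 0, ∃ N, ∀ n ≥ N, ∀ x : E,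
      ‖x‖ ^ k * ‖iteratedFDeriv ℝ l (u n) x - g l x‖ ≤ ε := by
    intro k l ε hε
    obtain ⟨N, hN⟩ := eventually_seminorm_sub_lt hu k l hε
    refine ⟨N, fun n hn x => ?_⟩
    refine le_of_tendsto (((hg l x).const_sub _).norm.const_mul (‖x‖ ^ k)) ?_
    filter_upwards [Filter.eventually_ge_atTop N] with m hm
    exact (norm_pow_mul_iteratedFDeriv_sub_le (u n) (u m) k l x).trans (hN n hn m hm).le
  have hunif : ∀ l, TendstoUniformly (fun n x => iteratedFDeriv ℝ l (u n) x) (g l)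
      Filter.atTop := by
    intro l
    rw [Metric.tendstoUniformly_iff]
    intro ε hε
    obtain ⟨N, hN⟩ := hbound 0 l (ε / 2) (half_pos hε)
    filter_upwards [Filter.eventually_ge_atTop N] with n hn x
    have := hN n hn x
    rw [dist_comm, dist_eq_norm]
    simp only [pow_zero, one_mul] at this
    linarith
  let p : E → FormalMultilinearSeries ℝ E F := fun x l => g l x
  have htaylor : HasFTaylorSeriesUpTo ∞ (fun x => (g 0 x).curry0) p := by
    have hderiv : ∀ (l : ℕ) (x : E), HasFDerivAt (fun y => p y l) (p x l.succ).curryLeft x := by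
      intro l x
      have hT : TendstoUniformly
          (fun n y => (continuousMultilinearCurryLeftEquiv ℝ (fun _ : Fin (l + 1) => E) F)
            (iteratedFDeriv ℝ (l + 1) (u n) y))
          (fun y => (continuousMultilinearCurryLeftEquiv ℝ (fun _ : Fin (l + 1) => E) F)
            (g (l + 1) y)) Filter.atTop :=
        (continuousMultilinearCurryLeftEquiv ℝ (fun _ : Fin (l + 1) => E)
          F).isometry.uniformContinuous.comp_tendstoUniformly (hunif (l + 1))
      refine hasFDerivAt_of_tendstoUniformly hT (f := fun n y => iteratedFDeriv ℝ l (u n) y)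
        (fun n y => ?_) (hg l) x
      exact (contDiff_iff_ftaylorSeries.1 ((u n).smooth ⊤)).fderiv l
        (by exact_mod_cast ENat.natCast_lt_top l) y
    refine ⟨fun x => rfl, fun l _ x => hderiv l x, fun l _ => ?_⟩
    exact continuous_iff_continuousAt.2 fun x => (hderiv l x).continuousAt
  have hiter : ∀ l x, iteratedFDeriv ℝ l (fun x => (g 0 x).curry0) x = g l x := fun l x =>
    (htaylor.eq_iteratedFDeriv (by exact_mod_cast le_top) x).symm
  let f : 𝓢(E, F) :=
    { toFun := fun x => (g 0 x).curry0
      smooth' := htaylor.contDiff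
      decay' := by
        intro k l
        obtain ⟨N, hN⟩ := hbound k l 1 one_pos
        refine ⟨SchwartzMap.seminorm ℝ k l (u N) + 1, fun x => ?_⟩
        rw [hiter]
        have h1 := hN N le_rfl x
        have h2 := SchwartzMap.le_seminorm ℝ k l (u N) x
        have h3 : ‖g l x‖ ≤ ‖iteratedFDeriv ℝ l (u N) x‖ +
            ‖iteratedFDeriv ℝ l (u N) x - g l x‖ := by
          have := norm_sub_le (iteratedFDeriv ℝ l (u N) x) (iteratedFDeriv ℝ l (u N) x - g l x)
          simpa using this
        calc ‖x‖ ^ k * ‖g l x‖ ≤ ‖x‖ ^ k * (‖iteratedFDeriv ℝ l (u N) x‖ +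
            ‖iteratedFDeriv ℝ l (u N) x - g l x‖) := by gcongr
          _ ≤ _ := by rw [mul_add]; linarith }
  refine ⟨f, ((schwartz_withSeminorms ℝ E F).tendsto_nhds_atTop u f).2 fun ⟨k, l⟩ ε hε => ?_⟩
  obtain ⟨N, hN⟩ := hbound k l (ε / 2) (half_pos hε)
  refine ⟨N, fun n hn => lt_of_le_of_lt ?_ (half_lt_self hε)⟩
  refine SchwartzMap.seminorm_le_bound ℝ k l _ (half_pos hε).le fun x => ?_
  have := hN n hn x
  rw [← hiter] at this
  rwa [show ((u n - f : 𝓢(E, F)) : E → F) = (u n : E → F) - f from rfl,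
    iteratedFDeriv_sub_apply ((u n).smooth l).contDiffAt (f.smooth l).contDiffAt]

/-- A complete space with countably generated uniformity is Baire, and Baire spaces are barrelled.
-/
instance instBarrelledSpace [CompleteSpace F] : BarrelledSpace ℝ 𝓢(E, F) := by
  have : (uniformity 𝓢(E, F)).IsCountablyGenerated :=
    IsUniformAddGroup.uniformity_countably_generated
  infer_instance

end SchwartzMap

/-- The product rule for the pairing of a weakly differentiable curve of continuous linear forms
with a differentiable curve in a barrelled space. -/
theorem HasDerivAt.pairing_curve {F : Type*} [AddCommGroup F] [Module ℝ F] [UniformSpace F]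
    [IsUniformAddGroup F] [ContinuousSMul ℝ F] [BarrelledSpace ℝ F]
    {D : ℝ → F →L[ℝ] ℝ} {D' : ℝ → F → ℝ} {w : ℝ → F} {w' : F} {t : ℝ}
    (hD : ∀ τ χ, HasDerivAt (fun τ => D τ χ) (D' τ χ) τ) (hw : HasDerivAt w w' t) :
    HasDerivAt (fun τ => D τ (w τ)) (D' t (w t) + D t w') t := by
  have hcont : ∀ χ, Continuous fun τ => D τ χ := fun χ =>
    continuous_iff_continuousAt.2 fun τ => (hD τ χ).continuousAt
  -- On a compact time interval each τ ↦ D τ χ is continuous, hence bounded; Banach–Steinhaus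
  -- upgrades this to equicontinuity.
  have hequi : UniformEquicontinuous
      ((↑) ∘ fun τ : Set.Icc (t - 1) (t + 1) => D τ : Set.Icc (t - 1) (t + 1) → F → ℝ) := by
    refine (norm_withSeminorms ℝ ℝ).banach_steinhaus fun _ χ => ?_
    have hK := (isCompact_Icc (a := t - 1) (b := t + 1)).image (hcont χ).norm
    refine hK.bddAbove.mono ?_
    rintro _ ⟨τ, rfl⟩
    exact ⟨τ, τ.2, rfl⟩
  -- Here both the form and its argument move; equicontinuity makes the value small uniformly in the
  -- form.
  have hsmall : Filter.Tendsto
      (fun h : ℝ => D (t + h) (h⁻¹ • (w (t + h) - w t - h • w'))) (𝓝 0) (𝓝 0) := by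
    rw [hasDerivAt_iff_tendsto_inv_smul] at hw
    rw [Metric.tendsto_nhds]
    intro ε hε
    have h1 := hw.eventually (Metric.equicontinuousAt_iff_right.1 (hequi.equicontinuous 0) ε hε)
    have h2 : ∀ᶠ h : ℝ in 𝓝 0, h ∈ Set.Icc (-1 : ℝ) 1 :=
      Icc_mem_nhds (by norm_num) (by norm_num)
    filter_upwards [h1, h2] with h hh1 hh2
    have := hh1 ⟨t + h, by constructor <;> linarith [hh2.1, hh2.2]⟩
    simpa [dist_comm] using this
  have h1 : Filter.Tendsto (fun h : ℝ => D (t + h) w' - D t w') (𝓝 0) (𝓝 0) := by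
    have := ((hcont w').comp (continuous_const_add t)).tendsto 0
    simpa using this.sub_const (D t w')
  have h2 := hasDerivAt_iff_tendsto_inv_smul.1 (hD t (w t))
  rw [hasDerivAt_iff_tendsto_inv_smul]
  -- The remainder splits into three: that of w under D (t + h), the variation of D on w', and the
  -- remainder of D on the fixed vector w t.
  have := (hsmall.add h1).add h2
  simp only [add_zero] at this
  refine this.congr fun h => ?_
  rcases eq_or_ne h 0 with rfl | hc
  · simp
  · simp only [map_smul, map_sub, smul_eq_mul]
    field_simp
    ring

noncomputable section

namespace Peierls

/-! ### The function `sin √ρ / √ρ` -/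

/-- The coefficients of the power series of `sin √ρ / √ρ`. -/
def sincSqrtCoeff (k : ℕ) : ℝ := (-1) ^ k / (2 * k + 1).factorial

/-- The entire function `sin √ρ / √ρ`. -/
def sincSqrt : ℝ → ℝ := FormalMultilinearSeries.ofScalarsSum sincSqrtCoeff

/-- Ratio test: consecutive coefficients have ratio 1/((2n+3)(2n+2)) in absolute value, which is at
most 1/(n+1). -/
theorem sincSqrt_radius : (FormalMultilinearSeries.ofScalars ℝ sincSqrtCoeff).radius = ⊤ := by
  have hne : ∀ n, sincSqrtCoeff n ≠ 0 := fun n => by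
    unfold sincSqrtCoeff
    positivity
  refine FormalMultilinearSeries.ofScalars_radius_eq_top_of_tendsto _ _
    (Filter.Eventually.of_forall hne) ?_
  refine squeeze_zero (fun n => by positivity) (fun n => ?_)
    (tendsto_one_div_add_atTop_nhds_zero_nat (𝕜 := ℝ))
  have h1 : ((2 * (n + 1) + 1).factorial : ℝ) =
      (2 * n + 3) * ((2 * n + 2) * (2 * n + 1).factorial) := by
    rw [show 2 * (n + 1) + 1 = (2 * n + 1 + 1) + 1 by ring, Nat.factorial_succ (2 * n + 1 + 1),
      Nat.factorial_succ (2 * n + 1)]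
    push_cast
    ring
  have hf : (0 : ℝ) < (2 * n + 1).factorial := by positivity
  simp only [sincSqrtCoeff, Nat.succ_eq_add_one, norm_div, norm_pow, norm_neg, norm_one, one_pow,
    Real.norm_natCast]
  rw [h1, div_div_div_eq, one_mul, mul_one, div_le_div_iff₀ (by positivity) (by positivity)]
  have hn : (0 : ℝ) ≤ n := n.cast_nonneg
  have h2 : (n + 1 : ℝ) ≤ (2 * n + 3) * (2 * n + 2) := by nlinarith
  nlinarith [mul_le_mul_of_nonneg_left h2 hf.le]

theorem contDiff_sincSqrt {k : WithTop ℕ∞} : ContDiff ℝ k sincSqrt := by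
  have h := (FormalMultilinearSeries.ofScalars ℝ sincSqrtCoeff).hasFPowerSeriesOnBall
    (by rw [sincSqrt_radius]; exact ENNReal.zero_lt_top)
  have h2 := h.analyticOnNhd
  rw [sincSqrt_radius, Metric.eball_top] at h2
  exact h2.contDiff

theorem sincSqrt_sq_mul (x : ℝ) : sincSqrt (x ^ 2) * x = Real.sin x := by
  rw [sincSqrt, FormalMultilinearSeries.ofScalars_sum_eq, ← tsum_mul_right,
    ← (Real.hasSum_sin x).tsum_eq]
  refine tsum_congr fun k => ?_
  simp only [sincSqrtCoeff, smul_eq_mul]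
  ring

theorem sincSqrt_zero : sincSqrt 0 = 1 := by
  rw [sincSqrt, FormalMultilinearSeries.ofScalarsSum_zero]
  simp [sincSqrtCoeff]

theorem sincSqrt_eq_div {ρ : ℝ} (hρ : 0 < ρ) : sincSqrt ρ = Real.sin √ρ / √ρ := by
  have h := sincSqrt_sq_mul √ρ
  rw [Real.sq_sqrt hρ.le] at h
  rw [← h, mul_div_cancel_right₀ _ (Real.sqrt_pos.2 hρ).ne']

/-- The function `cos √ρ`, as a smooth function on the line. -/
def cosSqrt (ρ : ℝ) : ℝ := sincSqrt ρ + 2 * ρ * deriv sincSqrt ρ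

theorem contDiff_cosSqrt : ContDiff ℝ ∞ cosSqrt := by
  have h : ContDiff ℝ ∞ (deriv sincSqrt) :=
    (contDiff_infty_iff_deriv.1 (contDiff_sincSqrt (k := ∞))).2
  have := contDiff_sincSqrt (k := ∞)
  unfold cosSqrt
  fun_prop

theorem cosSqrt_eq {ρ : ℝ} (hρ : 0 < ρ) : cosSqrt ρ = Real.cos √ρ := by
  have hs := Real.sqrt_pos.2 hρ
  have h1 : HasDerivAt (fun ρ => Real.sin √ρ / √ρ)
      ((Real.cos √ρ * (1 / (2 * √ρ)) * √ρ - Real.sin √ρ * (1 / (2 * √ρ))) / √ρ ^ 2) ρ :=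
    ((Real.hasDerivAt_sin _).comp ρ (Real.hasDerivAt_sqrt hρ.ne')).div
      (Real.hasDerivAt_sqrt hρ.ne') hs.ne'
  have h2 : sincSqrt =ᶠ[𝓝 ρ] fun ρ => Real.sin √ρ / √ρ := by
    filter_upwards [lt_mem_nhds hρ] with x hx using sincSqrt_eq_div hx
  rw [cosSqrt, h2.deriv_eq, h1.deriv, sincSqrt_eq_div hρ, Real.sq_sqrt hρ.le]
  field_simp
  ring

theorem deriv_cosSqrt {ρ : ℝ} (hρ : 0 < ρ) : deriv cosSqrt ρ = -(1 / 2) * sincSqrt ρ := by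
  have hs := Real.sqrt_pos.2 hρ
  have h1 : HasDerivAt (fun ρ => Real.cos √ρ) (-Real.sin √ρ * (1 / (2 * √ρ))) ρ :=
    (Real.hasDerivAt_cos _).comp ρ (Real.hasDerivAt_sqrt hρ.ne')
  have h2 : cosSqrt =ᶠ[𝓝 ρ] fun ρ => Real.cos √ρ := by
    filter_upwards [lt_mem_nhds hρ] with x hx using cosSqrt_eq hx
  rw [h2.deriv_eq, h1.deriv, sincSqrt_eq_div hρ]
  field_simp

/-! ### Bounds for all derivatives on the half-line -/

theorem iteratedDeriv_succ_cosSqrt (k : ℕ) {ρ : ℝ} (hρ : 0 < ρ) :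
    iteratedDeriv (k + 1) cosSqrt ρ = -(1 / 2) * iteratedDeriv k sincSqrt ρ := by
  have h : deriv cosSqrt =ᶠ[𝓝 ρ] fun x => -(1 / 2) * sincSqrt x := by
    filter_upwards [lt_mem_nhds hρ] with x hx using deriv_cosSqrt hx
  rw [iteratedDeriv_succ', h.iteratedDeriv_eq, iteratedDeriv_const_mul_field]

/-- This is the definition of `cosSqrt` differentiated k times. Together with the previous lemma it
gives a recursion for the derivatives without trigonometric expressions. -/
theorem two_mul_iteratedDeriv_succ_sincSqrt (k : ℕ) (ρ : ℝ) :
    2 * ρ * iteratedDeriv (k + 1) sincSqrt ρ =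
      iteratedDeriv k cosSqrt ρ - (2 * k + 1) * iteratedDeriv k sincSqrt ρ := by
  induction k generalizing ρ with
  | zero => simp [cosSqrt, iteratedDeriv_one]
  | succ k ih =>
    have hd : ∀ j x, HasDerivAt (iteratedDeriv j sincSqrt) (iteratedDeriv (j + 1) sincSqrt x) x :=
      fun j x => by
        rw [iteratedDeriv_succ]
        exact ((contDiff_sincSqrt (k := ∞)).differentiable_iteratedDeriv j
          (by exact_mod_cast ENat.natCast_lt_top j) x).hasDerivAt
    have hc : ∀ j x, HasDerivAt (iteratedDeriv j cosSqrt) (iteratedDeriv (j + 1) cosSqrt x) x :=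
      fun j x => by
        rw [iteratedDeriv_succ]
        exact (contDiff_cosSqrt.differentiable_iteratedDeriv j
          (by exact_mod_cast ENat.natCast_lt_top j) x).hasDerivAt
    have h1 := ((hasDerivAt_id ρ).const_mul 2).mul (hd (k + 1) ρ)
    have h2 := (hc k ρ).sub ((hd k ρ).const_mul (2 * (k : ℝ) + 1))
    have h3 := h1.unique (h2.congr_of_eventuallyEq (Filter.Eventually.of_forall fun x => ih x))
    simp only [id] at h3
    push_cast
    linarith

theorem exists_bound_iteratedDeriv_sincSqrt_of_one_le (k : ℕ) :
    ∃ C, ∀ ρ, 1 ≤ ρ → |iteratedDeriv k sincSqrt ρ| ≤ C ∧ |iteratedDeriv k cosSqrt ρ| ≤ C := by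
  induction k with
  | zero =>
    refine ⟨1, fun ρ hρ => ?_⟩
    have hρ0 : 0 < ρ := by linarith
    have hs : 1 ≤ √ρ := Real.one_le_sqrt.2 hρ
    simp only [iteratedDeriv_zero]
    rw [cosSqrt_eq hρ0, sincSqrt_eq_div hρ0, abs_div, abs_of_pos (by linarith : 0 < √ρ)]
    refine ⟨?_, Real.abs_cos_le_one _⟩
    rw [div_le_one (by linarith)]
    exact (Real.abs_sin_le_one _).trans hs
  | succ k ih =>
    obtain ⟨C, hC⟩ := ih
    -- The recursion bounds 2ρ times the next derivative by C + (2k+1)C, and 2ρ ≥ 1.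
    refine ⟨(2 * k + 2) * C, fun ρ hρ => ?_⟩
    obtain ⟨h1, h2⟩ := hC ρ hρ
    have hC0 : 0 ≤ C := (abs_nonneg _).trans h1
    have hk : (0 : ℝ) ≤ k := k.cast_nonneg
    constructor
    · have h3 := two_mul_iteratedDeriv_succ_sincSqrt k ρ
      have h4 : 2 * ρ * |iteratedDeriv (k + 1) sincSqrt ρ| ≤ C + (2 * k + 1) * C := by
        rw [← abs_of_pos (by linarith : 0 < 2 * ρ), ← abs_mul, h3]
        refine (abs_sub _ _).trans ?_
        rw [abs_mul, abs_of_nonneg (by linarith : (0 : ℝ) ≤ 2 * k + 1)]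
        gcongr
      nlinarith [abs_nonneg (iteratedDeriv (k + 1) sincSqrt ρ)]
    · rw [iteratedDeriv_succ_cosSqrt k (by linarith), abs_mul]
      norm_num
      nlinarith [mul_nonneg hk hC0]

theorem exists_bound_iteratedDeriv_sincSqrt (k : ℕ) :
    ∃ C, ∀ ρ, 0 ≤ ρ → |iteratedDeriv k sincSqrt ρ| ≤ C := by
  obtain ⟨C₁, h₁⟩ := exists_bound_iteratedDeriv_sincSqrt_of_one_le k
  have hc : Continuous (iteratedDeriv k sincSqrt) :=
    (contDiff_sincSqrt (k := k)).continuous_iteratedDeriv k le_rfl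
  obtain ⟨C₂, h₂⟩ := (isCompact_Icc (a := (0 : ℝ)) (b := 1)).exists_bound_of_continuousOn
    hc.continuousOn
  refine ⟨max C₁ C₂, fun ρ hρ => ?_⟩
  rcases le_total 1 ρ with h | h
  · exact (h₁ ρ h).1.trans (le_max_left _ _)
  · exact (h₂ ρ ⟨hρ, h⟩).trans (le_max_right _ _)

/-- The composition is controlled on [0, ∞) only: for negative ρ the function is sinh √|ρ| / √|ρ|,
which grows faster than any polynomial. -/
theorem hasTemperateGrowth_sincSqrt_comp {D : Type*} [NormedAddCommGroup D] [NormedSpace ℝ D]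
    {f : D → ℝ} (hf : f.HasTemperateGrowth) (hpos : ∀ x, 0 ≤ f x) :
    Function.HasTemperateGrowth fun x => sincSqrt (f x) := by
  choose C hC using exists_bound_iteratedDeriv_sincSqrt
  refine Function.HasTemperateGrowth.comp' (g := sincSqrt) (t := Set.Ici 0) ?_ (uniqueDiffOn_Ici 0)
    contDiff_sincSqrt.contDiffOn (fun N => ?_) hf
  · rintro _ ⟨x, rfl⟩
    exact hpos x
  · have hC0 : ∀ k, 0 ≤ C k := fun k => (abs_nonneg _).trans (hC k 0 le_rfl)
    refine ⟨0, ∑ k ∈ Finset.range (N + 1), C k, Finset.sum_nonneg fun k _ => hC0 k,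
      fun k hk x hx => ?_⟩
    rw [iteratedFDerivWithin_eq_iteratedFDeriv (uniqueDiffOn_Ici 0)
      contDiff_sincSqrt.contDiffAt hx, norm_iteratedFDeriv_eq_norm_iteratedDeriv, pow_zero, mul_one]
    exact (hC k x hx).trans (Finset.single_le_sum (fun i _ => hC0 i)
      (Finset.mem_range.2 (Nat.lt_succ_of_le hk)))

end Peierls

/-! ### Multiplication by functions depending on a parameter -/

namespace SchwartzMap

variable {V F : Type*} [NormedAddCommGroup V] [NormedSpace ℝ V]
  [NormedAddCommGroup F] [NormedSpace ℝ F]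

/-- The factor |h| comes from the mean value inequality in the parameter, starting from the
vanishing slice at 0, at the price of one more derivative of Φ. -/
theorem norm_iteratedFDeriv_slice_le {Φ : ℝ × V → ℝ} (hΦ : Φ.HasTemperateGrowth)
    (h0 : ∀ ξ, Φ (0, ξ) = 0) (k : ℕ) : ∃ (K : ℕ) (C : ℝ), 0 ≤ C ∧ ∀ i ≤ k, ∀ h : ℝ, |h| ≤ 1 → ∀ ξ,
      ‖iteratedFDeriv ℝ i (fun ξ => Φ (h, ξ)) ξ‖ ≤ C * |h| * (1 + ‖ξ‖) ^ K := by
  obtain ⟨K, C, hC, hbound⟩ := hΦ.norm_iteratedFDeriv_le_uniform (k + 1)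
  -- For |τ| ≤ 1 one has 1 + ‖(τ, ξ)‖ ≤ 2 (1 + ‖ξ‖), whence the factor 2 ^ K.
  refine ⟨K, C * 2 ^ K, by positivity, fun i hi h hh ξ => ?_⟩
  have hslice : ∀ τ : ℝ, iteratedFDeriv ℝ i (fun ξ => Φ (τ, ξ)) ξ =
      (iteratedFDeriv ℝ i Φ (τ, ξ)).compContinuousLinearMap
        fun _ => ContinuousLinearMap.inr ℝ ℝ V := by
    intro τ
    have hsm : ContDiff ℝ i fun z => Φ ((τ, 0) + z) :=
      (hΦ.1.of_le (by exact_mod_cast le_top)).comp (contDiff_const.add contDiff_id)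
    have := (ContinuousLinearMap.inr ℝ ℝ V).iteratedFDeriv_comp_right hsm ξ le_rfl
    rw [iteratedFDeriv_comp_add_left] at this
    simpa [Function.comp_def] using this
  have hmvt : ‖iteratedFDeriv ℝ i Φ (h, ξ) - iteratedFDeriv ℝ i Φ (0, ξ)‖ ≤
      C * (2 * (1 + ‖ξ‖)) ^ K * ‖(h, ξ) - ((0 : ℝ), ξ)‖ := by
    refine Convex.norm_image_sub_le_of_norm_fderiv_le (𝕜 := ℝ)
      (s := Metric.closedBall (0 : ℝ) 1 ×ˢ {ξ}) (fun x _ => ?_) (fun x hx => ?_)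
      ((convex_closedBall 0 1).prod (convex_singleton ξ)) ?_ ?_
    · exact hΦ.1.differentiable_iteratedFDeriv (by exact_mod_cast ENat.natCast_lt_top i) x
    · rw [norm_fderiv_iteratedFDeriv]
      refine (hbound (i + 1) (by omega) x).trans ?_
      obtain ⟨hx1, hx2⟩ := hx
      rw [mem_closedBall_zero_iff] at hx1
      rw [Set.mem_singleton_iff] at hx2
      have : ‖x‖ ≤ 1 + ‖ξ‖ := by
        rw [Prod.norm_def, hx2]
        exact max_le (by linarith [norm_nonneg ξ]) (by linarith)
      gcongr
      linarith [norm_nonneg ξ]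
    · exact ⟨by simp, rfl⟩
    · exact ⟨by simpa using hh, rfl⟩
  have hzero : iteratedFDeriv ℝ i (fun ξ => Φ (0, ξ)) ξ = 0 := by
    have : (fun ξ => Φ (0, ξ)) = 0 := funext h0
    rw [this]
    simp
  have hnorm : ‖(h, ξ) - ((0 : ℝ), ξ)‖ = |h| := by simp [Prod.norm_def]
  rw [hnorm] at hmvt
  have hinr : ‖ContinuousLinearMap.inr ℝ ℝ V‖ ≤ 1 := ContinuousLinearMap.norm_inr_le_one ℝ ℝ V
  calc ‖iteratedFDeriv ℝ i (fun ξ => Φ (h, ξ)) ξ‖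
      = ‖(iteratedFDeriv ℝ i Φ (h, ξ) - iteratedFDeriv ℝ i Φ (0, ξ)).compContinuousLinearMap
          fun _ => ContinuousLinearMap.inr ℝ ℝ V‖ := by
        rw [← sub_zero (iteratedFDeriv ℝ i (fun ξ => Φ (h, ξ)) ξ), ← hzero, hslice, hslice]
        congr 1
    _ ≤ ‖iteratedFDeriv ℝ i Φ (h, ξ) - iteratedFDeriv ℝ i Φ (0, ξ)‖ *
          ∏ _j : Fin i, ‖ContinuousLinearMap.inr ℝ ℝ V‖ :=
        ContinuousMultilinearMap.norm_compContinuousLinearMap_le _ _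
    _ ≤ ‖iteratedFDeriv ℝ i Φ (h, ξ) - iteratedFDeriv ℝ i Φ (0, ξ)‖ * 1 := by
        gcongr
        exact Finset.prod_le_one (fun _ _ => norm_nonneg _) fun _ _ => hinr
    _ ≤ _ := by
        rw [mul_one]
        refine hmvt.trans (le_of_eq ?_)
        rw [mul_pow]
        ring

theorem _root_.Function.HasTemperateGrowth.slice {Φ : ℝ × V → ℝ} (hΦ : Φ.HasTemperateGrowth)
    (h : ℝ) : Function.HasTemperateGrowth fun ξ => Φ (h, ξ) := by
  have h1 : Function.HasTemperateGrowth fun ξ : V => (h, ξ) := by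
    have : (fun ξ : V => (h, ξ)) = (fun _ => (h, 0)) + ⇑(ContinuousLinearMap.inr ℝ ℝ V) := by
      ext ξ <;> simp
    rw [this]
    exact (Function.HasTemperateGrowth.const _).add
      (ContinuousLinearMap.inr ℝ ℝ V).hasTemperateGrowth
  exact hΦ.comp h1

/-- By the Leibniz rule and the slice bound every seminorm is O(|h|); the polynomial growth of Φ is
absorbed by higher weights on f. -/
theorem tendsto_smulLeftCLM_slice {Φ : ℝ × V → ℝ} (hΦ : Φ.HasTemperateGrowth)
    (h0 : ∀ ξ, Φ (0, ξ) = 0) (f : 𝓢(V, F)) :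
    Filter.Tendsto (fun h => smulLeftCLM F (fun ξ => Φ (h, ξ)) f) (𝓝 0) (𝓝 0) := by
  rw [(schwartz_withSeminorms ℝ V F).tendsto_nhds' _ _]
  intro s ε hε
  suffices H : ∀ kl : ℕ × ℕ, ∀ δ > 0, ∀ᶠ h in 𝓝 (0 : ℝ),
      schwartzSeminormFamily ℝ V F kl (smulLeftCLM F (fun ξ => Φ (h, ξ)) f) < δ by
    have := (Filter.eventually_all_finset s).2 fun kl _ => H kl ε hε
    filter_upwards [this] with h hh
    rw [sub_zero]
    exact Seminorm.finset_sup_apply_lt hε hh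
  rintro ⟨k, l⟩ δ hδ
  obtain ⟨K, C, hC, hbound⟩ := norm_iteratedFDeriv_slice_le hΦ h0 l
  set M := ∑ i ∈ Finset.range (l + 1), (l.choose i : ℝ) * C *
    (2 ^ (K + k) * ((Finset.Iic (K + k, l)).sup fun m => SchwartzMap.seminorm ℝ m.1 m.2) f) with hM
  have hM0 : 0 ≤ M := Finset.sum_nonneg fun i _ => by positivity
  have hsem : ∀ h : ℝ, |h| ≤ 1 →
      SchwartzMap.seminorm ℝ k l (smulLeftCLM F (fun ξ => Φ (h, ξ)) f) ≤ M * |h| := by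
    intro h hh
    refine SchwartzMap.seminorm_le_bound ℝ k l _ (by positivity) fun ξ => ?_
    have hfun : (smulLeftCLM F (fun ξ => Φ (h, ξ)) f : V → F) = fun ξ => Φ (h, ξ) • f ξ := by
      ext ξ
      exact smulLeftCLM_apply_apply (hΦ.slice h) f ξ
    rw [hfun]
    have hle := norm_iteratedFDeriv_smul_le (𝕜 := ℝ) (n := l) ((hΦ.slice h).1) (f.smooth ⊤) ξ
      (by exact_mod_cast le_top)
    calc ‖ξ‖ ^ k * ‖iteratedFDeriv ℝ l (fun ξ => Φ (h, ξ) • f ξ) ξ‖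
        ≤ ‖ξ‖ ^ k * ∑ i ∈ Finset.range (l + 1), (l.choose i : ℝ) *
          ‖iteratedFDeriv ℝ i (fun ξ => Φ (h, ξ)) ξ‖ * ‖iteratedFDeriv ℝ (l - i) f ξ‖ := by gcongr
      _ = ∑ i ∈ Finset.range (l + 1), ‖ξ‖ ^ k * ((l.choose i : ℝ) *
          ‖iteratedFDeriv ℝ i (fun ξ => Φ (h, ξ)) ξ‖ * ‖iteratedFDeriv ℝ (l - i) f ξ‖) :=
        Finset.mul_sum _ _ _
      _ ≤ ∑ i ∈ Finset.range (l + 1), (l.choose i : ℝ) * C * (2 ^ (K + k) *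
          ((Finset.Iic (K + k, l)).sup fun m => SchwartzMap.seminorm ℝ m.1 m.2) f) * |h| := by
        refine Finset.sum_le_sum fun i hi => ?_
        have h1 := hbound i (by simpa [Nat.lt_succ_iff] using hi) h hh ξ
        have h2 := SchwartzMap.one_add_le_sup_seminorm_apply (𝕜 := ℝ) (m := (K + k, l))
          (k := K + k) (n := l - i) le_rfl (Nat.sub_le _ _) f ξ
        have h3 : ‖ξ‖ ^ k ≤ (1 + ‖ξ‖) ^ k := by
          gcongr
          linarith
        calc ‖ξ‖ ^ k * ((l.choose i : ℝ) * ‖iteratedFDeriv ℝ i (fun ξ => Φ (h, ξ)) ξ‖ *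
              ‖iteratedFDeriv ℝ (l - i) f ξ‖)
            ≤ (1 + ‖ξ‖) ^ k * ((l.choose i : ℝ) * (C * |h| * (1 + ‖ξ‖) ^ K) *
              ‖iteratedFDeriv ℝ (l - i) f ξ‖) := by gcongr
          _ = (l.choose i : ℝ) * C * |h| *
              ((1 + ‖ξ‖) ^ (K + k) * ‖iteratedFDeriv ℝ (l - i) f ξ‖) := by
            rw [pow_add]
            ring
          _ ≤ (l.choose i : ℝ) * C * |h| * (2 ^ (K + k) *
              ((Finset.Iic (K + k, l)).sup fun m => SchwartzMap.seminorm ℝ m.1 m.2) f) := by gcongr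
          _ = _ := by ring
      _ = M * |h| := by rw [hM, Finset.sum_mul]
  have hlim : Filter.Tendsto (fun h : ℝ => M * |h|) (𝓝 0) (𝓝 0) := by
    have : Continuous fun h : ℝ => M * |h| := by fun_prop
    simpa using this.tendsto 0
  have h1 : ∀ᶠ h : ℝ in 𝓝 0, |h| ≤ 1 := by
    filter_upwards [Icc_mem_nhds (by norm_num : (-1 : ℝ) < 0) one_pos] with h hh
    exact abs_le.2 hh
  filter_upwards [hlim.eventually (gt_mem_nhds hδ), h1] with h hh hh1
  exact (hsem h hh1).trans_lt hh

end SchwartzMap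

end

noncomputable section

namespace Peierls

/-! ### The multipliers of the Klein–Gordon equation -/

section Multiplier

variable {V : Type*}

/-- The function `sin (t √r) / √r`. -/
def sinMult (r : V → ℝ) (t : ℝ) (ξ : V) : ℝ := t * sincSqrt (t ^ 2 * r ξ)

/-- The function `cos (t √r)`. -/
def cosMult (r : V → ℝ) (t : ℝ) (ξ : V) : ℝ := 1 - 2 * r ξ * sinMult r (t / 2) ξ ^ 2

theorem sinMult_mul_sqrt {r : V → ℝ} {ξ : V} (hr : 0 ≤ r ξ) (t : ℝ) :
    sinMult r t ξ * √(r ξ) = Real.sin (t * √(r ξ)) := by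
  rw [← sincSqrt_sq_mul (t * √(r ξ)), mul_pow, Real.sq_sqrt hr, sinMult]
  ring

theorem cosMult_eq {r : V → ℝ} {ξ : V} (hr : 0 ≤ r ξ) (t : ℝ) :
    cosMult r t ξ = Real.cos (t * √(r ξ)) := by
  have h1 := sinMult_mul_sqrt hr (t / 2)
  have h2 : t * √(r ξ) = 2 * (t / 2 * √(r ξ)) := by ring
  have h3 : r ξ * sinMult r (t / 2) ξ ^ 2 = Real.sin (t / 2 * √(r ξ)) ^ 2 := by
    rw [← h1, mul_pow, Real.sq_sqrt hr]
    ring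
  rw [h2, Real.cos_two_mul, Real.cos_sq', ← h3, cosMult]
  ring

/-- Multiplication by √r reduces the claim to the addition theorem of sine; at r = 0 the multipliers
degenerate to t and 1. -/
theorem sinMult_add {r : V → ℝ} {ξ : V} (hr : 0 ≤ r ξ) (t h : ℝ) :
    sinMult r (t + h) ξ = cosMult r t ξ * sinMult r h ξ + sinMult r t ξ * cosMult r h ξ := by
  rcases hr.eq_or_lt with h0 | h0
  · simp [sinMult, cosMult, ← h0, sincSqrt_zero, add_comm]
  · have hs := Real.sqrt_pos.2 h0
    refine mul_right_cancel₀ hs.ne' ?_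
    have h1 : (cosMult r t ξ * sinMult r h ξ + sinMult r t ξ * cosMult r h ξ) * √(r ξ) =
        cosMult r t ξ * (sinMult r h ξ * √(r ξ)) + (sinMult r t ξ * √(r ξ)) * cosMult r h ξ := by
      ring
    rw [h1, sinMult_mul_sqrt hr, sinMult_mul_sqrt hr, sinMult_mul_sqrt hr, cosMult_eq hr,
      cosMult_eq hr, add_mul, Real.sin_add]
    ring

theorem cosMult_add {r : V → ℝ} {ξ : V} (hr : 0 ≤ r ξ) (t h : ℝ) :
    cosMult r (t + h) ξ = cosMult r t ξ * cosMult r h ξ - r ξ * sinMult r t ξ * sinMult r h ξ := by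
  have h3 : r ξ * sinMult r t ξ * sinMult r h ξ =
      (sinMult r t ξ * √(r ξ)) * (sinMult r h ξ * √(r ξ)) := by
    calc _ = sinMult r t ξ * sinMult r h ξ * √(r ξ) ^ 2 := by
          rw [Real.sq_sqrt hr]
          ring
      _ = _ := by ring
  rw [h3, sinMult_mul_sqrt hr, sinMult_mul_sqrt hr, cosMult_eq hr, cosMult_eq hr, cosMult_eq hr,
    add_mul, Real.cos_add]

variable [NormedAddCommGroup V] [NormedSpace ℝ V] {r : V → ℝ}

theorem hasTemperateGrowth_sinMult (hr : r.HasTemperateGrowth) (hr0 : ∀ ξ, 0 ≤ r ξ) (t : ℝ) :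
    (sinMult r t).HasTemperateGrowth :=
  (Function.HasTemperateGrowth.const t).mul (hasTemperateGrowth_sincSqrt_comp
    ((Function.HasTemperateGrowth.const (t ^ 2)).mul hr)
    fun ξ => mul_nonneg (sq_nonneg t) (hr0 ξ))

/-- The half-angle form of `cosMult` reduces this to the sine multiplier, so no separate estimate
for the cosine is needed. -/
theorem hasTemperateGrowth_cosMult (hr : r.HasTemperateGrowth) (hr0 : ∀ ξ, 0 ≤ r ξ) (t : ℝ) :
    (cosMult r t).HasTemperateGrowth :=
  (Function.HasTemperateGrowth.const 1).sub
    (((Function.HasTemperateGrowth.const 2).mul hr).mul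
      ((hasTemperateGrowth_sinMult hr hr0 (t / 2)).pow 2))

theorem hasTemperateGrowth_fst : Function.HasTemperateGrowth fun p : ℝ × V => p.1 :=
  (ContinuousLinearMap.fst ℝ ℝ V).hasTemperateGrowth

theorem hasTemperateGrowth_comp_snd (hr : r.HasTemperateGrowth) :
    Function.HasTemperateGrowth fun p : ℝ × V => r p.2 :=
  Function.HasTemperateGrowth.comp hr (ContinuousLinearMap.snd ℝ ℝ V).hasTemperateGrowth

variable {F : Type*} [NormedAddCommGroup F] [NormedSpace ℝ F]

open SchwartzMap Function

theorem tendsto_smulLeftCLM_sinMult (hr : r.HasTemperateGrowth) (hr0 : ∀ ξ, 0 ≤ r ξ)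
    (f : 𝓢(V, F)) :
    Filter.Tendsto (fun h : ℝ => h⁻¹ • (smulLeftCLM F (sinMult r h) f - h • f)) (𝓝 0) (𝓝 0) := by
  -- The quotient (sin(h√r)/√r - h)/h, extended smoothly by 0 to h = 0.
  have hΦ : HasTemperateGrowth fun p : ℝ × V => sincSqrt (p.1 ^ 2 * r p.2) - 1 :=
    (hasTemperateGrowth_sincSqrt_comp
      ((hasTemperateGrowth_fst.pow 2).mul (hasTemperateGrowth_comp_snd hr))
      fun p => mul_nonneg (sq_nonneg _) (hr0 _)).sub (HasTemperateGrowth.const 1)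
  have h1 := tendsto_smulLeftCLM_slice hΦ (by simp [sincSqrt_zero]) f
  refine h1.congr fun h => ?_
  ext ξ
  rcases eq_or_ne h 0 with rfl | hh
  · rw [smulLeftCLM_apply_apply (hΦ.slice 0)]
    simp [sincSqrt_zero]
  · rw [smulLeftCLM_apply_apply (hΦ.slice h), smul_apply, sub_apply, smul_apply,
      smulLeftCLM_apply_apply (hasTemperateGrowth_sinMult hr hr0 h), ← sub_smul, smul_smul, sinMult]
    congr 1
    field_simp

theorem tendsto_smulLeftCLM_cosMult (hr : r.HasTemperateGrowth) (hr0 : ∀ ξ, 0 ≤ r ξ)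
    (f : 𝓢(V, F)) :
    Filter.Tendsto (fun h : ℝ => h⁻¹ • (smulLeftCLM F (cosMult r h) f - f)) (𝓝 0) (𝓝 0) := by
  -- By the half-angle formula this is (cos(h√r) - 1)/h, smooth with the value 0 at h = 0.
  have hΦ : HasTemperateGrowth fun p : ℝ × V =>
      p.1 * (-(1 / 2) * (r p.2 * sincSqrt ((p.1 * (1 / 2)) ^ 2 * r p.2) ^ 2)) :=
    hasTemperateGrowth_fst.mul ((HasTemperateGrowth.const _).mul
      ((hasTemperateGrowth_comp_snd hr).mul ((hasTemperateGrowth_sincSqrt_comp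
        (((hasTemperateGrowth_fst.mul (HasTemperateGrowth.const _)).pow 2).mul
          (hasTemperateGrowth_comp_snd hr))
        fun p => mul_nonneg (sq_nonneg _) (hr0 _)).pow 2)))
  have h1 := tendsto_smulLeftCLM_slice hΦ (by simp) f
  refine h1.congr fun h => ?_
  ext ξ
  rcases eq_or_ne h 0 with rfl | hh
  · rw [smulLeftCLM_apply_apply (hΦ.slice 0)]
    simp
  · rw [smulLeftCLM_apply_apply (hΦ.slice h), smul_apply, sub_apply,
      smulLeftCLM_apply_apply (hasTemperateGrowth_cosMult hr hr0 h)]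
    nth_rewrite 3 [← one_smul ℝ (f ξ)]
    rw [← sub_smul, smul_smul, cosMult, sinMult]
    congr 1
    field_simp
    ring

/-- The addition formula moves the difference quotient from t to 0, where the two preceding limits
apply, and the fixed multipliers at time t act continuously. -/
theorem hasDerivAt_smulLeftCLM_sinMult (hr : r.HasTemperateGrowth) (hr0 : ∀ ξ, 0 ≤ r ξ)
    (f : 𝓢(V, F)) (t : ℝ) :
    HasDerivAt (fun t => smulLeftCLM F (sinMult r t) f) (smulLeftCLM F (cosMult r t) f) t := by
  have hS := hasTemperateGrowth_sinMult hr hr0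
  have hC := hasTemperateGrowth_cosMult hr hr0
  rw [hasDerivAt_iff_tendsto_inv_smul]
  have h1 := ((smulLeftCLM F (cosMult r t)).continuous.tendsto 0).comp
    (tendsto_smulLeftCLM_sinMult hr hr0 f)
  have h2 := ((smulLeftCLM F (sinMult r t)).continuous.tendsto 0).comp
    (tendsto_smulLeftCLM_cosMult hr hr0 f)
  have h3 := h1.add h2
  simp only [map_zero, add_zero] at h3
  refine h3.congr fun h => ?_
  ext ξ
  simp only [Function.comp_apply, add_apply, sub_apply, smul_apply, smulLeftCLM_apply_apply (hS _),
    smulLeftCLM_apply_apply (hC _), sinMult_add (hr0 ξ)]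
  module

theorem hasDerivAt_smulLeftCLM_cosMult (hr : r.HasTemperateGrowth) (hr0 : ∀ ξ, 0 ≤ r ξ)
    (f : 𝓢(V, F)) (t : ℝ) :
    HasDerivAt (fun t => smulLeftCLM F (cosMult r t) f)
      (-smulLeftCLM F r (smulLeftCLM F (sinMult r t) f)) t := by
  have hS := hasTemperateGrowth_sinMult hr hr0
  have hC := hasTemperateGrowth_cosMult hr hr0
  rw [hasDerivAt_iff_tendsto_inv_smul]
  have h1 := ((smulLeftCLM F (cosMult r t)).continuous.tendsto 0).comp
    (tendsto_smulLeftCLM_cosMult hr hr0 f)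
  have h2 := (((smulLeftCLM F r).comp (smulLeftCLM F (sinMult r t))).continuous.tendsto 0).comp
    (tendsto_smulLeftCLM_sinMult hr hr0 f)
  have h3 := h1.sub h2
  simp only [map_zero, sub_zero] at h3
  refine h3.congr fun h => ?_
  ext ξ
  simp only [Function.comp_apply, ContinuousLinearMap.comp_apply, neg_apply, sub_apply, smul_apply,
    smulLeftCLM_apply_apply (hS _), smulLeftCLM_apply_apply (hC _), smulLeftCLM_apply_apply hr,
    cosMult_add (hr0 ξ)]
  module

end Multiplier

/-! ### Solution of the Cauchy problem -/

section Propagator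

open SchwartzMap FourierTransform

variable {n : ℕ}

/-- The symbol of the operator `-Δ + m²`. -/
def kgSymbol (m : ℝ) (ξ : Space n) : ℝ := (2 * Real.pi) ^ 2 * ‖ξ‖ ^ 2 + m ^ 2

theorem hasTemperateGrowth_kgSymbol (m : ℝ) : (kgSymbol (n := n) m).HasTemperateGrowth := by
  unfold kgSymbol
  fun_prop

theorem kgSymbol_nonneg (m : ℝ) (ξ : Space n) : 0 ≤ kgSymbol m ξ := by
  unfold kgSymbol
  positivity

/-- The inclusion of real into complex Schwartz functions. -/
def ofRealS : Test n →L[ℝ] 𝓢(Space n, ℂ) := postcompCLM Complex.ofRealCLM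

/-- The real part of a complex Schwartz function. -/
def reS : 𝓢(Space n, ℂ) →L[ℝ] Test n := postcompCLM Complex.reCLM

theorem reS_ofRealS (χ : Test n) : reS (ofRealS χ) = χ := by
  ext x
  simp [reS, ofRealS]

theorem reS_laplacian (f : 𝓢(Space n, ℂ)) : reS (Δ f) = Δ (reS f) := by
  ext x
  rw [laplacian_apply]
  simp only [reS, postcompCLM_apply]
  rw [laplacian_apply]
  have h := (f.smooth 2).contDiffAt (x := x)
  exact (h.laplacian_CLM_comp_left (l := Complex.reCLM)).symm

/-- The operator `sin (t √(-Δ + m²)) / √(-Δ + m²)`, mapping the initial velocity to the solution. -/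
def sinProp (m t : ℝ) : Test n →L[ℝ] Test n :=
  reS ∘L fourierMultiplierCLM ℂ (sinMult (kgSymbol m) t) ∘L ofRealS

/-- The operator `cos (t √(-Δ + m²))`, mapping the initial value to the solution. -/
def cosProp (m t : ℝ) : Test n →L[ℝ] Test n :=
  reS ∘L fourierMultiplierCLM ℂ (cosMult (kgSymbol m) t) ∘L ofRealS

theorem sinProp_zero (m : ℝ) (χ : Test n) : sinProp m 0 χ = 0 := by
  have h : sinMult (kgSymbol (n := n) m) 0 = fun _ => 0 := by
    ext ξ
    simp [sinMult]
  simp [sinProp, h, fourierMultiplierCLM_const]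

theorem cosProp_zero (m : ℝ) (χ : Test n) : cosProp m 0 χ = χ := by
  have h : cosMult (kgSymbol (n := n) m) 0 = fun _ => 1 := by
    ext ξ
    simp [cosMult, sinMult]
  simp [cosProp, h, fourierMultiplierCLM_const, reS_ofRealS]

/-- The derivative is taken on the Fourier side and carried back by the continuous real-linear map
"real part of the inverse Fourier transform". -/
theorem hasDerivAt_sinProp (m : ℝ) (χ : Test n) (t : ℝ) :
    HasDerivAt (fun t => sinProp m t χ) (cosProp m t χ) t :=
  (hasDerivAt_smulLeftCLM_sinMult (hasTemperateGrowth_kgSymbol m) (kgSymbol_nonneg m)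
    (𝓕 (ofRealS χ)) t).clm_apply_curve (reS ∘L fourierInvCLM ℝ 𝓢(Space n, ℂ))

theorem fourierMultiplierCLM_kgSymbol (m : ℝ) (f : 𝓢(Space n, ℂ)) :
    fourierMultiplierCLM ℂ (kgSymbol m) f = -(Δ f - m ^ 2 • f) := by
  have hsq : Function.HasTemperateGrowth fun ξ : Space n => ‖ξ‖ ^ 2 := by fun_prop
  have h : smulLeftCLM ℂ (kgSymbol m) (𝓕 f) =
      (2 * Real.pi) ^ 2 • smulLeftCLM ℂ (fun ξ : Space n => ‖ξ‖ ^ 2) (𝓕 f) + m ^ 2 • 𝓕 f := by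
    ext ξ
    simp only [add_apply, smul_apply, smulLeftCLM_apply_apply hsq,
      smulLeftCLM_apply_apply (hasTemperateGrowth_kgSymbol m), kgSymbol]
    module
  rw [fourierMultiplierCLM_apply, h, fourierInv_add, fourierInv_smul, fourierInv_smul,
    fourierInv_fourier_eq, ← fourierMultiplierCLM_apply, laplacian_eq_fourierMultiplierCLM]
  module

theorem hasDerivAt_cosProp (m : ℝ) (χ : Test n) (t : ℝ) :
    HasDerivAt (fun t => cosProp m t χ) (Δ (sinProp m t χ) - m ^ 2 • sinProp m t χ) t := by
  have h := (hasDerivAt_smulLeftCLM_cosMult (hasTemperateGrowth_kgSymbol m) (kgSymbol_nonneg m)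
    (𝓕 (ofRealS χ)) t).clm_apply_curve (reS ∘L fourierInvCLM ℝ 𝓢(Space n, ℂ))
  have h1 : smulLeftCLM ℂ (sinMult (kgSymbol m) t) (𝓕 (ofRealS χ)) =
      𝓕 (fourierMultiplierCLM ℂ (sinMult (kgSymbol m) t) (ofRealS χ)) := by
    rw [fourierMultiplierCLM_apply, fourier_fourierInv_eq]
  rw [h1, map_neg, ContinuousLinearMap.comp_apply, fourierInvCLM_apply,
    ← fourierMultiplierCLM_apply, fourierMultiplierCLM_kgSymbol, map_neg, neg_neg, map_sub, map_smul,
    reS_laplacian] at h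
  exact h

end Propagator

end Peierls

end

noncomputable section

namespace Peierls

variable {n : ℕ} {m : ℝ}

/-! ### Solutions of the Klein–Gordon equation -/

/-- The operator `Δ - m²`. -/
def kgOp (m : ℝ) : Test n →L[ℝ] Test n :=
  LineDeriv.laplacianCLM ℝ (Space n) (Test n) - m ^ 2 • ContinuousLinearMap.id ℝ (Test n)

theorem kgOp_apply (χ : Test n) : kgOp m χ = Δ χ - m ^ 2 • χ := rfl

theorem IsKleinGordon.map {u v : ℝ → Test n} (h : IsKleinGordon m u v) (L : Test n →L[ℝ] Test n)
    (hL : ∀ χ, L (Δ χ) = Δ (L χ)) : IsKleinGordon m (fun t => L (u t)) fun t => L (v t) where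
  velocity t := (h.velocity t).clm_apply_curve L
  equation t := by
    have := (h.equation t).clm_apply_curve L
    rwa [map_sub, map_smul, hL] at this

theorem IsKleinGordon.shift {u v : ℝ → Test n} (h : IsKleinGordon m u v) (s : ℝ) :
    IsKleinGordon m (fun t => u (s + t)) fun t => v (s + t) where
  velocity t := by simpa using (h.velocity (s + 1 * t)).comp_affine 1
  equation t := by simpa using (h.equation (s + 1 * t)).comp_affine 1

theorem IsKleinGordon.reverse {u v : ℝ → Test n} (h : IsKleinGordon m u v) :
    IsKleinGordon m (fun t => u (-t)) fun t => -v (-t) where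
  velocity t := by simpa using (h.velocity (0 + -1 * t)).comp_affine (-1)
  equation t := by
    have := ((h.equation (0 + -1 * t)).comp_affine (-1)).clm_apply_curve
      (-ContinuousLinearMap.id ℝ (Test n))
    simpa using this

theorem isKleinGordon_sinProp (χ : Test n) :
    IsKleinGordon m (fun t => sinProp m t χ) fun t => cosProp m t χ :=
  ⟨hasDerivAt_sinProp m χ, hasDerivAt_cosProp m χ⟩

theorem isKleinGordon_cosProp (χ : Test n) :
    IsKleinGordon m (fun t => cosProp m t χ) fun t => kgOp m (sinProp m t χ) where
  velocity t := hasDerivAt_cosProp m χ t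
  equation t := (hasDerivAt_sinProp m χ t).clm_apply_curve (kgOp m)

theorem IsKleinGordon.add {u₁ v₁ u₂ v₂ : ℝ → Test n} (h₁ : IsKleinGordon m u₁ v₁)
    (h₂ : IsKleinGordon m u₂ v₂) :
    IsKleinGordon m (fun t => u₁ t + u₂ t) fun t => v₁ t + v₂ t where
  velocity t := (h₁.velocity t).add_curve (h₂.velocity t)
  equation t := by
    have := (h₁.equation t).add_curve (h₂.equation t)
    rwa [← kgOp_apply, ← kgOp_apply, ← map_add, kgOp_apply] at this

theorem exists_isCauchySolution (φ π : Test n) : ∃ u v, IsCauchySolution m φ π u v :=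
  ⟨_, _, (isKleinGordon_sinProp π).add (isKleinGordon_cosProp φ),
    by simp [sinProp_zero, cosProp_zero], by simp [sinProp_zero, cosProp_zero]⟩

/-- A curve of tempered distributions solves the Klein–Gordon equation weakly. -/
structure IsWeakKleinGordon (m : ℝ) (D D' : ℝ → Dist n) : Prop where
  velocity : ∀ t χ, HasDerivAt (fun τ => D τ χ) (D' t χ) t
  equation : ∀ t χ, HasDerivAt (fun τ => D' τ χ) (D t (kgOp m χ)) t

/-- The quantity D (t - τ) (v τ) + D' (t - τ) (u τ) has derivative zero: the terms of the product
rule cancel in pairs. Its values at τ = 0 and τ = t are the two sides. -/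
theorem IsWeakKleinGordon.duality {D D' : ℝ → Dist n} (hD : IsWeakKleinGordon m D D')
    {u v : ℝ → Test n} (h : IsKleinGordon m u v) (t : ℝ) :
    D t (v 0) + D' t (u 0) = D 0 (v t) + D' 0 (u t) := by
  have h1 : ∀ τ χ, HasDerivAt (fun τ => D (t - τ) χ) ((-D' (t - τ)) χ) τ := fun τ χ => by
    simpa using (hD.velocity (t - τ) χ).comp_const_sub t τ
  have h2 : ∀ τ χ, HasDerivAt (fun τ => D' (t - τ) χ) (-D (t - τ) (kgOp m χ)) τ := fun τ χ => by
    simpa using (hD.equation (t - τ) χ).comp_const_sub t τ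
  have h3 : ∀ τ, HasDerivAt (fun τ => D (t - τ) (v τ) + D' (t - τ) (u τ)) 0 τ := fun τ => by
    have := (HasDerivAt.pairing_curve h1 (h.equation τ)).add
      (HasDerivAt.pairing_curve h2 (h.velocity τ))
    refine this.congr_deriv ?_
    rw [kgOp_apply, neg_apply]
    ring
  have h4 := is_const_of_deriv_eq_zero (fun τ => (h3 τ).differentiableAt) (fun τ => (h3 τ).deriv) 0 t
  simpa using h4

/-- Duality against the Schwartz solution with data (0, χ); a weak solution is thus determined by
its initial data. -/
theorem IsWeakKleinGordon.eq_prop {D D' : ℝ → Dist n} (hD : IsWeakKleinGordon m D D') (t : ℝ)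
    (χ : Test n) : D t χ = D 0 (cosProp m t χ) + D' 0 (sinProp m t χ) := by
  simpa [sinProp_zero, cosProp_zero] using hD.duality (isKleinGordon_sinProp χ) t

/-! ### Schwartz solutions as weak solutions, and their uniqueness -/

theorem ofFunction_apply (f χ : Test n) : ofFunction f χ = ∫ x, f x * χ x := by
  simp [ofFunction, SchwartzMap.integralCLM_apply,
    SchwartzMap.smulLeftCLM_apply_apply f.hasTemperateGrowth]

theorem ofFunction_comm (f g : Test n) : ofFunction f g = ofFunction g f := by
  simp only [ofFunction_apply, mul_comm]

theorem ofFunction_kgOp (f g : Test n) : ofFunction f (kgOp m g) = ofFunction g (kgOp m f) := by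
  have h : ofFunction f (Δ g) = ofFunction g (Δ f) := by
    rw [ofFunction_apply, ofFunction_comm, ofFunction_apply]
    exact SchwartzMap.integral_mul_laplacian_right_eq_left f g
  rw [kgOp_apply, kgOp_apply, map_sub, map_sub, map_smul, map_smul, h, ofFunction_comm f g]

theorem IsKleinGordon.isWeakKleinGordon {u v : ℝ → Test n} (h : IsKleinGordon m u v) :
    IsWeakKleinGordon m (fun t => ofFunction (u t)) fun t => ofFunction (v t) where
  velocity t χ := by
    simp only [fun f : Test n => ofFunction_comm f χ]
    exact (h.velocity t).clm_apply_curve (ofFunction χ)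
  equation t χ := by
    rw [ofFunction_kgOp]
    simp only [fun f : Test n => ofFunction_comm f χ]
    exact (h.equation t).clm_apply_curve (ofFunction χ)

/-- Tested with f - g itself, the hypothesis says that the continuous function (f - g)² has integral
zero. -/
theorem ofFunction_injective {f g : Test n}
    (h : ∀ χ, ofFunction f χ = ofFunction g χ) : f = g := by
  have h1 : ofFunction (f - g) (f - g) = 0 := by
    have := h (f - g)
    rw [ofFunction_comm f, ofFunction_comm g] at this
    rw [map_sub, this, sub_self]
  rw [ofFunction_apply] at h1
  have hint : MeasureTheory.Integrable fun x => (f - g) x * (f - g) x := by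
    have := (SchwartzMap.smulLeftCLM ℝ (f - g) (f - g)).integrable (μ := MeasureTheory.volume)
    refine this.congr (Filter.Eventually.of_forall fun x => ?_)
    rw [SchwartzMap.smulLeftCLM_apply_apply (f - g).hasTemperateGrowth, smul_eq_mul]
  have h2 := (MeasureTheory.integral_eq_zero_iff_of_nonneg
    (fun x => mul_self_nonneg ((f - g) x)) hint).1 h1
  have h3 := (Continuous.ae_eq_iff_eq MeasureTheory.volume
    ((f - g).continuous.mul (f - g).continuous) continuous_const).1 h2
  ext x
  have h4 := congrFun h3 x
  have h5 : (f - g) x = 0 := mul_self_eq_zero.1 h4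
  exact sub_eq_zero.1 h5

theorem IsKleinGordon.ofFunction_eq {u v : ℝ → Test n} (h : IsKleinGordon m u v) (t s : ℝ)
    (χ : Test n) : ofFunction (u t) χ =
      ofFunction (u s) (cosProp m (t - s) χ) + ofFunction (v s) (sinProp m (t - s) χ) := by
  simpa using (h.shift s).isWeakKleinGordon.eq_prop (t - s) χ

theorem IsKleinGordon.eq_prop {u v : ℝ → Test n} (h : IsKleinGordon m u v) (t : ℝ) :
    u t = sinProp m t (v 0) + cosProp m t (u 0) := by
  refine ofFunction_injective fun χ => ?_
  have h2 := ((isKleinGordon_sinProp (m := m) (v 0)).add (isKleinGordon_cosProp (u 0)))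
  have h3 := h2.ofFunction_eq t 0 χ
  simp only [sinProp_zero, cosProp_zero, map_zero, zero_add, add_zero] at h3
  rw [h3, h.ofFunction_eq t 0]

/-- Both sides solve the equation with initial data (0, L χ), so uniqueness applies. The parity and
addition rules below follow in the same way from time reversal and time shift. -/
theorem map_sinProp (L : Test n →L[ℝ] Test n) (hL : ∀ χ, L (Δ χ) = Δ (L χ)) (t : ℝ) (χ : Test n) :
    L (sinProp m t χ) = sinProp m t (L χ) := by
  simpa [sinProp_zero, cosProp_zero] using ((isKleinGordon_sinProp (m := m) χ).map L hL).eq_prop t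

theorem map_cosProp (L : Test n →L[ℝ] Test n) (hL : ∀ χ, L (Δ χ) = Δ (L χ)) (t : ℝ) (χ : Test n) :
    L (cosProp m t χ) = cosProp m t (L χ) := by
  simpa [sinProp_zero, cosProp_zero] using ((isKleinGordon_cosProp (m := m) χ).map L hL).eq_prop t

theorem sinProp_neg (t : ℝ) (χ : Test n) : sinProp m (-t) χ = -sinProp m t χ := by
  simpa [sinProp_zero, cosProp_zero] using (isKleinGordon_sinProp (m := m) χ).reverse.eq_prop t

theorem cosProp_neg (t : ℝ) (χ : Test n) : cosProp m (-t) χ = cosProp m t χ := by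
  simpa [sinProp_zero, cosProp_zero] using (isKleinGordon_cosProp (m := m) χ).reverse.eq_prop t

theorem sinProp_add (s t : ℝ) (χ : Test n) :
    sinProp m (s + t) χ = sinProp m t (cosProp m s χ) + cosProp m t (sinProp m s χ) := by
  simpa using ((isKleinGordon_sinProp (m := m) χ).shift s).eq_prop t

theorem sinProp_sub (t s : ℝ) (χ : Test n) :
    sinProp m (t - s) χ = cosProp m s (sinProp m t χ) - sinProp m s (cosProp m t χ) := by
  rw [sub_eq_add_neg, sinProp_add, sinProp_neg, cosProp_neg, neg_add_eq_sub]

/-! ### Symmetries -/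

theorem translate_apply (a : Space n) (χ : Test n) (z : Space n) :
    translate a χ z = χ (z + a) := by
  simp [translate, sub_neg_eq_add]

theorem reflect_apply (χ : Test n) (z : Space n) : reflect χ z = χ (-z) := rfl

theorem dirac_apply (y : Space n) (χ : Test n) : dirac y χ = χ y := rfl

theorem translate_laplacian (a : Space n) (χ : Test n) :
    translate a (Δ χ) = Δ (translate a χ) := by
  ext z
  have h : (translate a χ : Space n → ℝ) = fun z => χ (z + a) := funext fun z =>
    translate_apply a χ z
  rw [translate_apply, SchwartzMap.laplacian_apply, SchwartzMap.laplacian_apply, h,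
    InnerProductSpace.laplacian_eq_iteratedFDeriv_stdOrthonormalBasis,
    InnerProductSpace.laplacian_eq_iteratedFDeriv_stdOrthonormalBasis]
  simp only [iteratedFDeriv_comp_add_right]

/-- Each directional derivative changes sign under reflection, and the Laplacian is a sum of second
ones. -/
theorem reflect_laplacian (χ : Test n) : reflect (Δ χ) = Δ (reflect χ) := by
  have h : ∀ (v : Space n) (ψ : Test n), ∂_{v} (reflect ψ) = -reflect (∂_{v} ψ) := fun v ψ => by
    have := SchwartzMap.lineDerivOp_compCLMOfContinuousLinearEquiv (𝕜 := ℝ) v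
      (ContinuousLinearEquiv.neg ℝ) ψ
    rw [reflect, this, ContinuousLinearEquiv.coe_neg, Pi.neg_apply, id,
      LineDeriv.lineDerivOp_left_neg, map_neg]
  simp only [SchwartzMap.laplacian_eq_sum (stdOrthonormalBasis ℝ (Space n)), map_sum, h,
    LineDeriv.lineDerivOp_neg, neg_neg]

/-! ### Convolution -/

/-- The transpose is determined by its values, so the one picked by choice is T. -/
theorem conv_eq {F : Dist n} {T : Test n →L[ℝ] Test n} (h : IsConvTranspose F T) (B : Dist n) :
    conv F B = B.comp T := by
  have h1 : IsConvolutor F := ⟨T, h⟩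
  have h2 : h1.choose = T := by
    ext χ x
    rw [h1.choose_spec χ x, h χ x]
  rw [conv, dif_pos h1, h2]

theorem convParam_eq {F : Dist n} {B C : Space n → Dist n} (h : IsConvParam F B C) :
    convParam F B = C := by
  have h1 : ∃ C, IsConvParam F B C := ⟨C, h⟩
  rw [convParam, dif_pos h1]
  ext y χ
  obtain ⟨ψ₁, h2, h3⟩ := h1.choose_spec y χ
  obtain ⟨ψ₂, h4, h5⟩ := h y χ
  have h6 : ψ₁ = ψ₂ := by
    ext z
    rw [h2, h4]
  rw [h3, h5, h6]

variable {P : Test n →L[ℝ] Test n}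

/-- A translation-invariant operator is recovered from its value at the origin. -/
theorem isConvTranspose_dirac_comp (ht : ∀ a χ, translate a (P χ) = P (translate a χ)) :
    IsConvTranspose ((dirac 0).comp P) P := fun χ x => by
  rw [ContinuousLinearMap.comp_apply, ← ht, dirac_apply, translate_apply, zero_add]

theorem convFun_dirac_comp (ht : ∀ a χ, translate a (P χ) = P (translate a χ))
    (hr : ∀ χ, reflect (P χ) = P (reflect χ)) (φ : Test n) (x : Space n) :
    convFun ((dirac 0).comp P) φ x = P φ x := by
  rw [convFun, ContinuousLinearMap.comp_apply, ← hr, ← ht, dirac_apply, reflect_apply,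
    translate_apply, neg_zero, zero_add]

theorem convParam_dirac_comp (ht : ∀ a χ, translate a (P χ) = P (translate a χ))
    (hr : ∀ χ, reflect (P χ) = P (reflect χ)) (T : Test n →L[ℝ] Test n) (c : ℝ) :
    convParam ((dirac 0).comp P) (fun w => (c • dirac w).comp T) =
      fun y => (c • dirac y).comp (P.comp T) := by
  -- As a function of z the inner pairing is c (T χ)(y - z), a reflected translate of T χ; this is
  -- why P must also commute with reflection.
  refine convParam_eq fun y χ => ⟨c • reflect (translate y (T χ)), fun z => ?_, ?_⟩
  · change c * reflect (translate y (T χ)) z = c * T χ (y - z)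
    rw [reflect_apply, translate_apply, neg_add_eq_sub]
  · change c * P (T χ) y = ((dirac 0).comp P) (c • reflect (translate y (T χ)))
    rw [map_smul, ContinuousLinearMap.comp_apply, ← hr, ← ht, dirac_apply, reflect_apply,
      translate_apply, neg_zero, zero_add, smul_eq_mul]

/-! ### Brackets of the canonical coordinates -/

/-- The formal kernel `c δ(x - y)`. -/
def FormalKernel.constDelta (c : ℝ) : FormalKernel n := fun p _ _ => if p = 0 then c else 0

theorem mderiv_zero : mderiv (0 : MultiIndex n) = ContinuousLinearMap.id ℝ (Test n) := by
  have : ∀ l : List (Fin n), (l.map fun _ => (1 : Test n →L[ℝ] Test n)).prod = 1 := fun l => by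
    simp
  simp only [mderiv, Finsupp.coe_zero, Pi.zero_apply, pow_zero, this]
  rfl

theorem FormalKernel.eval_constDelta (c : ℝ) (φ π : Test n) (y : Space n) :
    (FormalKernel.constDelta c).eval φ π y = c • dirac y := by
  rw [FormalKernel.eval, finsum_eq_single _ 0]
  · simp [FormalKernel.constDelta, SchwartzMap.smulLeftCLM_const, deltaDeriv, mderiv_zero]
  · intro p hp
    simp [FormalKernel.constDelta, hp, SchwartzMap.smulLeftCLM_const]

theorem FormalKernel.poissonOp_constDelta (c : ℝ) :
    (FormalKernel.constDelta (n := n) c).poissonOp = FormalKernel.constDelta 0 := by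
  funext p j k
  simp [FormalKernel.poissonOp, FormalKernel.constDelta, Coeff.d₁, Coeff.d₂]

theorem FormalKernel.iterate_poissonOp_constDelta (c : ℝ) (k : ℕ) :
    FormalKernel.poissonOp^[k + 1] (FormalKernel.constDelta (n := n) c) =
      FormalKernel.constDelta 0 := by
  induction k generalizing c with
  | zero => exact FormalKernel.poissonOp_constDelta c
  | succ k ih => rw [Function.iterate_succ_apply, FormalKernel.poissonOp_constDelta, ih]

theorem deriv_update_apply {ι : Type*} [DecidableEq ι] (j : ι → ℝ) (a b : ι) (x : ℝ) :
    deriv (fun s => Function.update j a s b) x = if a = b then 1 else 0 := by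
  rcases eq_or_ne a b with rfl | h
  · simp
  · simp [Function.update_of_ne h.symm, h]

theorem Coeff.d₁_d₂_mulDelta (a b e f : MultiIndex n ⊕ MultiIndex n)
    (q : MultiIndex n × MultiIndex n) (j k : Jet n) :
    Coeff.d₁ e (Coeff.d₂ f (FormalKernel.mulDelta (HamFun.coord a) (HamFun.coord b) q)) j k =
      if q = 0 ∧ e = a ∧ f = b then 1 else 0 := by
  by_cases hq : q = 0
  · simp only [Coeff.d₁, Coeff.d₂, FormalKernel.mulDelta, HamFun.coord, hq, if_true,
      deriv_const_mul_field, deriv_mul_const_field, deriv_update_apply]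
    by_cases h1 : e = a <;> by_cases h2 : f = b <;> simp [h1, h2]
  · simp [Coeff.d₁, Coeff.d₂, FormalKernel.mulDelta, hq]

/-- Only variables of order zero occur, so no derivative falls on δ and the kernel keeps its single
term at p = 0. -/
theorem FormalKernel.poissonOp_mulDelta_coord (a b : MultiIndex n ⊕ MultiIndex n)
    (ha : a = Sum.inl 0 ∨ a = Sum.inr 0) (hb : b = Sum.inl 0 ∨ b = Sum.inr 0) :
    (FormalKernel.mulDelta (HamFun.coord a) (HamFun.coord b)).poissonOp =
      FormalKernel.constDelta ((if Sum.inl 0 = a ∧ Sum.inr 0 = b then 1 else 0) -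
        if Sum.inr 0 = a ∧ Sum.inl 0 = b then 1 else 0) := by
  funext p j k
  simp only [FormalKernel.poissonOp, Coeff.d₁_d₂_mulDelta, FormalKernel.constDelta]
  obtain ⟨p₁, p₂⟩ := p
  by_cases hp : (p₁, p₂) = 0
  · obtain ⟨rfl, rfl⟩ := Prod.mk_eq_zero.1 hp
    have h0 : Finset.HasAntidiagonal.antidiagonal (0 : MultiIndex n) = {(0, 0)} := by simp
    simp only [h0, Finset.sum_singleton]
    simp
  · rw [if_neg hp]
    refine Finset.sum_eq_zero fun c hc => Finset.sum_eq_zero fun d hd => ?_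
    rw [Finset.HasAntidiagonal.mem_antidiagonal] at hc hd
    -- A nonzero summand would have all its multi-indices zero, contradicting p ≠ 0.
    have key : (c.2, d.2) = 0 → c.1 = 0 → d.1 = 0 → False := by
      intro h h1 h2
      obtain ⟨h3, h4⟩ := Prod.mk_eq_zero.1 h
      apply hp
      simp only at hc hd
      rw [← hc, ← hd, h1, h2, h3, h4]
      simp
    rw [if_neg, if_neg, sub_zero]
    · rintro ⟨h, h1, h2⟩
      rcases ha with rfl | rfl <;> rcases hb with rfl | rfl <;> simp at h1 h2
      exact key h h1 h2
    · rintro ⟨h, h1, h2⟩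
      rcases ha with rfl | rfl <;> rcases hb with rfl | rfl <;> simp at h1 h2
      exact key h h1 h2

theorem poissonOp_pi_phi : (FormalKernel.mulDelta (n := n) HamFun.pi HamFun.phi).poissonOp =
    FormalKernel.constDelta (-1) := by
  rw [HamFun.pi, HamFun.phi, FormalKernel.poissonOp_mulDelta_coord _ _ (by simp) (by simp)]
  simp

theorem poissonOp_phi_pi : (FormalKernel.mulDelta (n := n) HamFun.phi HamFun.pi).poissonOp =
    FormalKernel.constDelta 1 := by
  rw [HamFun.pi, HamFun.phi, FormalKernel.poissonOp_mulDelta_coord _ _ (by simp) (by simp)]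
  simp

theorem poissonOp_phi_phi : (FormalKernel.mulDelta (n := n) HamFun.phi HamFun.phi).poissonOp =
    FormalKernel.constDelta 0 := by
  rw [HamFun.phi, FormalKernel.poissonOp_mulDelta_coord _ _ (by simp) (by simp)]
  simp

theorem poissonOp_pi_pi : (FormalKernel.mulDelta (n := n) HamFun.pi HamFun.pi).poissonOp =
    FormalKernel.constDelta 0 := by
  rw [HamFun.pi, FormalKernel.poissonOp_mulDelta_coord _ _ (by simp) (by simp)]
  simp

theorem phi_jet (φ π : Test n) (x : Space n) : HamFun.phi.toFun (jet φ π x) = φ x := by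
  simp [HamFun.phi, HamFun.coord, jet, mderiv_zero]

theorem pi_jet (φ π : Test n) (x : Space n) : HamFun.pi.toFun (jet φ π x) = π x := by
  simp [HamFun.pi, HamFun.coord, jet, mderiv_zero]

/-- A first bracket with constant coefficient is annihilated by the next Poisson operator, so only
the coefficient of ħ survives, with 1/1! = 1. -/
theorem starDelta_succ_of_poissonOp {f g : HamFun n} {c : ℝ}
    (h : (FormalKernel.mulDelta f g).poissonOp = FormalKernel.constDelta c) (φ π : Test n)
    (y : Space n) (k : ℕ) :
    starDelta f g φ π y (k + 1) = if k = 0 then c • dirac y else 0 := by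
  rcases k with - | k
  · simp [starDelta, h, FormalKernel.eval_constDelta]
  · rw [starDelta, Function.iterate_succ_apply, h, FormalKernel.iterate_poissonOp_constDelta,
      FormalKernel.eval_constDelta]
    simp

theorem ofFunction_mul_const (f : Test n) (c : ℝ) :
    ofFunction (fun x => f x * c) = c • ofFunction f := by
  have h : (fun x => f x * c) = c • (f : Space n → ℝ) := by
    ext x
    simp [mul_comm]
  rw [h, ofFunction, SchwartzMap.smulLeftCLM_smul f.hasTemperateGrowth,
    ContinuousLinearMap.comp_smul, ofFunction]

/-! ### The Green function -/

/-- The Green function of the Klein–Gordon equation. -/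
def green (m t : ℝ) : Dist n := (dirac 0).comp (sinProp m t)

/-- The time derivative of the Green function. -/
def green' (m t : ℝ) : Dist n := (dirac 0).comp (cosProp m t)

theorem isGreenFunction_green : IsGreenFunction (n := n) m (green m) (green' m) where
  velocity t χ := (hasDerivAt_sinProp m χ t).clm_apply_curve (dirac 0)
  equation t χ := by
    have h := (hasDerivAt_cosProp m χ t).clm_apply_curve (dirac 0)
    -- The weak equation puts the operator on the test function; it commutes with the propagator
    -- because it commutes with Δ.
    rw [← kgOp_apply, map_sinProp] at h
    · exact h
    · intro ψ
      have h1 := map_sub (LineDeriv.laplacianCLM ℝ (Space n) (Test n)) (Δ ψ) (m ^ 2 • ψ)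
      rw [map_smul] at h1
      exact h1.symm
  init := by
    ext χ
    simp [green, sinProp_zero]
  init_velocity := by
    ext χ
    simp [green', cosProp_zero]

theorem IsGreenFunction.eq_green {D D' : ℝ → Dist n} (h : IsGreenFunction m D D') :
    D = green m ∧ D' = green' m := by
  have hD : D = green m := by
    ext t χ
    have := (IsWeakKleinGordon.mk (m := m) h.velocity h.equation).eq_prop t χ
    rw [h.init, h.init_velocity, zero_apply, zero_add] at this
    exact this
  refine ⟨hD, ?_⟩
  ext t χ
  have h1 := h.velocity t χ
  rw [hD] at h1
  exact h1.unique (isGreenFunction_green.velocity t χ)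

/-! ### Convolution with the Green function, brackets and star product -/

theorem isConvTranspose_green (t : ℝ) : IsConvTranspose (green (n := n) m t) (sinProp m t) :=
  isConvTranspose_dirac_comp fun a => map_sinProp _ (translate_laplacian a) t

theorem isConvTranspose_green' (t : ℝ) : IsConvTranspose (green' (n := n) m t) (cosProp m t) :=
  isConvTranspose_dirac_comp fun a => map_cosProp _ (translate_laplacian a) t

theorem shift_green (t : ℝ) (y : Space n) :
    shift (green m t) y = (dirac y).comp (sinProp m t) := by
  ext χ
  rw [shift, ContinuousLinearMap.comp_apply, ← isConvTranspose_green, ContinuousLinearMap.comp_apply,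
    dirac_apply]

theorem bracket_green (u v : ℝ → Test n) (t s : ℝ) (y : Space n) :
    bracket (green m) (green' m) u v t s y = -shift (green m (t - s)) y := by
  rw [bracket, conv_eq (isConvTranspose_green _), conv_eq (isConvTranspose_green' _), bracketDelta,
    bracketDelta, poissonOp_pi_phi, poissonOp_phi_phi, FormalKernel.eval_constDelta,
    FormalKernel.eval_constDelta, shift_green]
  ext χ
  simp

theorem convParam_green (t : ℝ) (T : Test n →L[ℝ] Test n) (c : ℝ) :
    convParam (green m t) (fun w => (c • dirac w).comp T) =
      fun y => (c • dirac y).comp ((sinProp m t).comp T) :=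
  convParam_dirac_comp (fun a => map_sinProp _ (translate_laplacian a) t)
    (map_sinProp _ reflect_laplacian t) T c

theorem convParam_green' (t : ℝ) (T : Test n →L[ℝ] Test n) (c : ℝ) :
    convParam (green' m t) (fun w => (c • dirac w).comp T) =
      fun y => (c • dirac y).comp ((cosProp m t).comp T) :=
  convParam_dirac_comp (fun a => map_cosProp _ (translate_laplacian a) t)
    (map_cosProp _ reflect_laplacian t) T c

theorem convFun_green (t : ℝ) (φ : Test n) (x : Space n) :
    convFun (green m t) φ x = sinProp m t φ x :=
  convFun_dirac_comp (fun a => map_sinProp _ (translate_laplacian a) t)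
    (map_sinProp _ reflect_laplacian t) φ x

theorem convFun_green' (t : ℝ) (φ : Test n) (x : Space n) :
    convFun (green' m t) φ x = cosProp m t φ x :=
  convFun_dirac_comp (fun a => map_cosProp _ (translate_laplacian a) t)
    (map_cosProp _ reflect_laplacian t) φ x

/-- The two mixed brackets contribute -C(s)S(t) + S(s)C(t), which is -S(t-s) by `sinProp_sub`; the
other two vanish. -/
theorem bracketInitial_green (φ π : Test n) (t s : ℝ) (y : Space n) :
    bracketInitial (green m) (green' m) φ π t s y = -shift (green m (t - s)) y := by
  simp only [bracketInitial, bracketDelta, poissonOp_pi_phi, poissonOp_phi_phi, poissonOp_phi_pi,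
    poissonOp_pi_pi, FormalKernel.eval_constDelta, conv_eq (isConvTranspose_green _),
    conv_eq (isConvTranspose_green' _), convParam_green, convParam_green', shift_green]
  ext χ
  simp only [ContinuousLinearMap.comp_apply, add_apply, neg_apply, sinProp_sub, map_sub,
    smul_apply]
  simp
  ring

theorem star_green {u v : ℝ → Test n} (h : IsKleinGordon m u v) (t s : ℝ) (y : Space n) :
    star (green m) (green' m) u v t s y =
      Pi.single (M := fun _ => Dist n) 0 (ofFunction fun x => u t x * u s y) +
        Pi.single (M := fun _ => Dist n) 1 (bracket (green m) (green' m) u v t s y) := by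
  funext k
  rw [star, conv_eq (isConvTranspose_green _), conv_eq (isConvTranspose_green' _), Pi.add_apply]
  rcases k with - | k
  · simp only [starDelta, phi_jet, pi_jet, Pi.single_eq_same, ofFunction_mul_const]
    rw [Pi.single_eq_of_ne (by simp), add_zero]
    ext χ
    simp only [add_apply, ContinuousLinearMap.comp_apply, smul_apply, smul_eq_mul]
    -- At order zero the factor u s y is constant in x, and the remaining sum propagates the field
    -- from time s to time t.
    rw [h.ofFunction_eq t s χ]
    ring
  · rw [starDelta_succ_of_poissonOp poissonOp_pi_phi, starDelta_succ_of_poissonOp poissonOp_phi_phi,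
      Pi.single_eq_of_ne (Nat.succ_ne_zero k), zero_add]
    rcases k with - | k
    · rw [bracket_green, shift_green]
      ext χ
      simp
    · rw [Pi.single_eq_of_ne (by omega)]
      simp

end Peierls

end

/-! ### The main theorem -/

theorem mainTheorem9 (n : ℕ) (m : ℝ) :
    ∃ G G' : ℝ → Peierls.Dist n,
      Peierls.IsGreenFunction m G G' ∧
      (∀ D D' : ℝ → Peierls.Dist n, Peierls.IsGreenFunction m D D' → D = G ∧ D' = G') ∧
      (∀ t, Peierls.IsConvolutor (G t) ∧ Peierls.IsConvolutor (G' t)) ∧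
      (∀ φ π : Peierls.Test n, ∃ u v : ℝ → Peierls.Test n, Peierls.IsCauchySolution m φ π u v) ∧
      ∀ (φ π : Peierls.Test n) (u v : ℝ → Peierls.Test n), Peierls.IsCauchySolution m φ π u v →
        (∀ t x, u t x = Peierls.convFun (G t) π x + Peierls.convFun (G' t) φ x) ∧
        (∀ t s y, Peierls.bracket G G' u v t s y = -Peierls.shift (G (t - s)) y) ∧
        (∀ t s y, Peierls.bracketInitial G G' φ π t s y = -Peierls.shift (G (t - s)) y) ∧
        (∀ t s y, Peierls.star G G' u v t s y =
          Pi.single (M := fun _ => Peierls.Dist n) 0 (Peierls.ofFunction fun x => u t x * u s y) +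
            Pi.single (M := fun _ => Peierls.Dist n) 1 (Peierls.bracket G G' u v t s y)) := by
  refine ⟨Peierls.green m, Peierls.green' m, Peierls.isGreenFunction_green,
    fun D D' h => h.eq_green, fun t => ⟨⟨_, Peierls.isConvTranspose_green t⟩,
      ⟨_, Peierls.isConvTranspose_green' t⟩⟩, Peierls.exists_isCauchySolution,
    fun φ π u v h => ⟨fun t x => ?_, Peierls.bracket_green u v, Peierls.bracketInitial_green φ π,
      Peierls.star_green h.toIsKleinGordon⟩⟩
  rw [Peierls.convFun_green, Peierls.convFun_green', h.eq_prop, h.init, h.init_velocity]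
  rfl
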